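/- For $\theta\in(-\pi,\pi]$ let $\rho(\theta)=2-\cos\theta-\sqrt{(2-\cos\theta)^2-1}\in(0,1]$ and $m_{\mathrm d}(\theta)=(-i\,\operatorname{sgn}\theta)\,\rho(\theta)^{1/2}e^{i\theta/2}$. For $g\in L^1(-\pi,\pi)$ put $\mathcal F^{-1}[g](n)=\frac1{2\pi}\int_{-\pi}^{\pi}g(\theta)e^{in\theta}\,d\theta$, $n\in\mathbb Z$. Define kernels on $\mathbb Z$ by $$K_{\mathrm d}=\mathcal F^{-1}[m_{\mathrm d}],\qquad K_{H^+}(n)=\frac{1}{\pi(n+\frac12)},\qquad D=K_{\mathrm d}-K_{H^+},$$ and, for complex sequences $a=(a_n)_{n\in\mathbb Z}$, the discrete Hilbert transform $H_{\mathrm d}a=K_{\mathrm d}*a$ and the Riesz–Titchmarsh transform $H^+a=K_{H^+}*a$, where $(K*a)(n)=\sum_{m\in\mathbb Z}K(n-m)a_m$. Then $D\in\ell^1(\mathbb Z)$. For every $1\le p<\infty$ and $a\in\ell^p(\mathbb Z)$ the series defining $H_{\mathrm d}a$, $H^+a$ and $D*a$ converge absolutely and $H_{\mathrm d}a=H^+a+D*a$.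 The operator $H_{\mathrm d}$ has Fourier multiplier $m_{\mathrm d}$: one has $H_{\mathrm d}a=\mathcal F^{-1}[m_{\mathrm d}\,\widehat a\,]$ for $a\in\ell^1(\mathbb Z)$, where $\widehat a(\theta)=\sum_n a_ne^{-in\theta}$, and likewise for $a\in\ell^2(\mathbb Z)$, where $\widehat a\in L^2(-\pi,\pi)$ is the function with $\mathcal F^{-1}[\widehat a\,]=a$. Moreover: 1. For every $1<p<\infty$ and $a\in\ell^p(\mathbb Z)$, $$\|H_{\mathrm d}a\|_{\ell^p}\le\|H^+a\|_{\ell^p}+\|D\|_{\ell^1}\|a\|_{\ell^p}.$$ 2. There is an absolute constant $C<\infty$ such that for all $a\in\ell^1(\mathbb Z)$ and $\lambda>0$, $$\#\{n:|H^+a(n)|>\lambda\}\le\frac{C\|a\|_{\ell^1}}{\lambda} \qquad\text{and}\qquad \#\{n:|H_{\mathrm d}a(n)|>\lambda\}\le\frac{C\|a\|_{\ell^1}}{\lambda}+\frac{\|D\|_{\ell^1}\|a\|_{\ell^1}}{\lambda}.$$ 3. Consequently $H_{\mathrm d}$ is of weak type $(1,1)$, and it is bounded on $\ell^p(\mathbb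 Z)$ for every $1<p<\infty$. -/

import Mathlib

open MeasureTheory
open scoped ENNReal NNReal

namespace DiscreteHilbert

/-- The `ℓ^p(ℤ)` norm of a complex sequence, as an extended nonnegative number
(it is `∞` exactly when the sequence is not in `ℓ^p`). -/
noncomputable def seqNorm (p : ℝ≥0∞) (a : ℤ → ℂ) : ℝ≥0∞ :=
  eLpNorm a p Measure.count

/-- `a ∈ ℓ^p(ℤ)`. -/
def MemSeq (p : ℝ≥0∞) (a : ℤ → ℂ) : Prop :=
  MemLp a p Measure.count

/-- The Fourier transform `â(θ) = ∑ₙ aₙ e^{-inθ}` of a summable sequence. -/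
noncomputable def fourierSeq (a : ℤ → ℂ) (θ : ℝ) : ℂ :=
  ∑' n : ℤ, a n * Complex.exp (-(Complex.I * (n : ℂ) * (θ : ℂ)))

/-- The inverse Fourier transform `(1 / 2π) ∫_{-π}^{π} g(θ) e^{inθ} dθ`. -/
noncomputable def invFourier (g : ℝ → ℂ) (n : ℤ) : ℂ :=
  (1 / (2 * (Real.pi : ℂ))) *
    ∫ θ in (-Real.pi)..Real.pi, g θ * Complex.exp (Complex.I * (n : ℂ) * (θ : ℂ))

/-- The root in `(0, 1]` of `ρ + ρ⁻¹ = 4 - 2 cos θ`. -/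
noncomputable def rho (θ : ℝ) : ℝ :=
  2 - Real.cos θ - Real.sqrt ((2 - Real.cos θ) ^ 2 - 1)

/-- The Fourier multiplier `(-i sgn θ) ρ(θ)^{1/2} e^{iθ/2}`. -/
noncomputable def multiplier (θ : ℝ) : ℂ :=
  (-Complex.I * (Real.sign θ : ℂ)) * (Real.sqrt (rho θ) : ℂ) *
    Complex.exp (Complex.I * (θ : ℂ) / 2)

/-- Convolution on `ℤ`: `(K * a)(n) = ∑ₘ K(n - m) aₘ`. -/
noncomputable def conv (K a : ℤ → ℂ) (n : ℤ) : ℂ :=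
  ∑' m : ℤ, K (n - m) * a m

/-- The kernel `K_d` of the discrete Hilbert transform. -/
noncomputable def kernelHd (n : ℤ) : ℂ :=
  invFourier multiplier n

/-- The Riesz–Titchmarsh kernel `1 / (π (n + 1/2))`. -/
noncomputable def kernelHplus (n : ℤ) : ℂ :=
  1 / ((Real.pi : ℂ) * ((n : ℂ) + 1 / 2))

/-- The difference kernel `D = K_d - K_{H⁺}`. -/
noncomputable def kernelD (n : ℤ) : ℂ :=
  kernelHd n - kernelHplus n

/-- The discrete Hilbert transform `H_d`. -/
noncomputable def Hd (a : ℤ → ℂ) : ℤ → ℂ :=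
  conv kernelHd a

/-- The Riesz–Titchmarsh transform `H⁺`. -/
noncomputable def Hplus (a : ℤ → ℂ) : ℤ → ℂ :=
  conv kernelHplus a

/-- The distribution function `#{n : |b(n)| > t}`, with value `∞` for an infinite set. -/
noncomputable def distrib (b : ℤ → ℂ) (t : ℝ) : ℝ≥0∞ :=
  (({n : ℤ | t < ‖b n‖}.encard : ℕ∞) : ℝ≥0∞)

/-- `T` is of weak type `(1,1)` with constant `C`:
`#{n : |Ta(n)| > t} ≤ C ‖a‖₁ / t` for all `a ∈ ℓ¹(ℤ)` and `t > 0`. -/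
def WeakType11With (C : ℝ≥0) (T : (ℤ → ℂ) → ℤ → ℂ) : Prop :=
  ∀ a : ℤ → ℂ, MemSeq 1 a → ∀ t : ℝ, 0 < t →
    distrib (T a) t ≤ (C : ℝ≥0∞) * seqNorm 1 a / ENNReal.ofReal t

/-- `T` maps `ℓ^p(ℤ)` into itself, with norm bounded by some finite constant. -/
def BoundedOn (p : ℝ≥0∞) (T : (ℤ → ℂ) → ℤ → ℂ) : Prop :=
  ∃ C : ℝ≥0, ∀ a : ℤ → ℂ, MemSeq p a →
    MemSeq p (T a) ∧ seqNorm p (T a) ≤ (C : ℝ≥0∞) * seqNorm p a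

end DiscreteHilbert

/-!
Why the theorem is true.

*Kernel.* Since `2 - cos θ = 1 + 2 sin² (θ/2)`, one has `ρ^{1/2} = √(1 + sin² (θ/2)) - |sin (θ/2)|`,
which on `[0, π]` is the restriction of the smooth function `sqrtRhoExt`. Hence `K_d(n)` is `1/π`
times the sine coefficient of `sqrtRhoExt` at the frequency `n + 1/2`. As `cos ((n + 1/2) π) = 0`
and `sqrtRhoExt 0 = 1`, the first integration by parts produces exactly `K_{H⁺}(n)`, and a second
one bounds the rest by `C / (n + 1/2)²` (`exists_kernelD_bound`); so `D ∈ ℓ¹`. Both kernels decay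
like `1/|n|`, so they lie in every `ℓ^q` with `q > 1`, and Hölder's inequality gives the absolute
convergence of all series. The norm comparison is Young's inequality (`seqNorm_conv_le`).

*Weak type of `H⁺`.* This is a discrete Loomis–Boole argument (`card_mul_le_of_half_kernel`). For a
finite set `S` of integers, partial fractions of `∏_{s ∈ S} (1 + c / (x - s))` with `c = ±1/2` have
residues `c v_s` with `v_s ≥ 0` and `∑ v_s = #S`, and the product is nonnegative at every
half-integer. Averaging the inequality `t ≤ ±∑ₘ bₘ / (s + 1/2 - m)`, `b ≥ 0`, over `s ∈ S` with
weights `v_s` therefore yields `t #S ≤ 2 ‖b‖₁`. The weak-type bound for `H_d` follows from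
`H_d = H⁺ + D *` and Chebyshev's inequality.

*Boundedness on `ℓ^p`.* The multiplier is bounded by `1`, so `H_d` is a contraction on `ℓ²` by
Parseval's identity. The Marcinkiewicz argument (`boundedOn_of_weakType`) gives `1 < p < 2`. Since
`K_d(-n) = -K_d(n - 1)`, the transpose of `H_d` is minus a shift of `H_d`, and duality
(`BoundedOn.dual`) gives `p > 2`.
-/

namespace DiscreteHilbert
open Filter Topology ComplexConjugate AddCircle

/-! ### Sequence norms, Hölder, Young and Chebyshev inequalities -/

lemma measurePreserving_equiv (e : ℤ ≃ ℤ) :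
    MeasurePreserving e (Measure.count : Measure ℤ) Measure.count := by
  refine ⟨measurable_of_countable _, ?_⟩
  ext s hs
  rw [Measure.map_apply (measurable_of_countable _) hs, ← Equiv.image_symm_eq_preimage,
    Measure.count_injective_image e.symm.injective]

lemma seqNorm_comp_equiv (p : ℝ≥0∞) (a : ℤ → ℂ) (e : ℤ ≃ ℤ) :
    seqNorm p (fun n => a (e n)) = seqNorm p a :=
  eLpNorm_comp_measurePreserving (AEStronglyMeasurable.of_discrete) (measurePreserving_equiv e)

lemma memSeq_iff {p : ℝ≥0∞} {a : ℤ → ℂ} : MemSeq p a ↔ seqNorm p a < ∞ :=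
  ⟨fun h => h.2, fun h => ⟨AEStronglyMeasurable.of_discrete, h⟩⟩

lemma MemSeq.comp_equiv {p : ℝ≥0∞} {a : ℤ → ℂ} (h : MemSeq p a) (e : ℤ ≃ ℤ) :
    MemSeq p (fun n => a (e n)) := by
  rw [memSeq_iff, seqNorm_comp_equiv]; exact h.2

lemma seqNorm_one (a : ℤ → ℂ) : seqNorm 1 a = ∑' n, ‖a n‖ₑ := by
  rw [seqNorm, eLpNorm_one_eq_lintegral_enorm, lintegral_count]

lemma seqNorm_eq {p : ℝ≥0∞} (h0 : p ≠ 0) (ht : p ≠ ∞) (a : ℤ → ℂ) :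
    seqNorm p a = (∑' n, ‖a n‖ₑ ^ p.toReal) ^ (1 / p.toReal) := by
  rw [seqNorm, eLpNorm_eq_lintegral_rpow_enorm_toReal h0 ht, lintegral_count]

lemma seqNorm_rpow {p : ℝ≥0∞} (h0 : p ≠ 0) (ht : p ≠ ∞) (a : ℤ → ℂ) :
    seqNorm p a ^ p.toReal = ∑' n, ‖a n‖ₑ ^ p.toReal := by
  have := ENNReal.toReal_pos h0 ht
  rw [seqNorm_eq h0 ht, ← ENNReal.rpow_mul, one_div_mul_cancel this.ne', ENNReal.rpow_one]

lemma memSeq_one_iff {a : ℤ → ℂ} : MemSeq 1 a ↔ Summable a := by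
  rw [MemSeq, memLp_one_iff_integrable, integrable_count_iff, summable_norm_iff]

lemma MemSeq.summable_mul {p q : ℝ≥0∞} [p.HolderConjugate q] {a b : ℤ → ℂ} (ha : MemSeq p a)
    (hb : MemSeq q b) : Summable (fun n => a n * b n) := by
  rw [← summable_norm_iff]
  exact integrable_count_iff.1 (MemLp.integrable_mul ha hb)

lemma summable_conv {p q : ℝ≥0∞} [p.HolderConjugate q] {K a : ℤ → ℂ} (hK : MemSeq p K)
    (ha : MemSeq q a) (n : ℤ) : Summable (fun m => K (n - m) * a m) :=
  (hK.comp_equiv (Equiv.subLeft n)).summable_mul ha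

/-- The spaces `ℓ^p(ℤ)` increase with `p`. -/
lemma MemSeq.mono {p q : ℝ≥0∞} (hp : p ≠ 0) (hpq : p ≤ q) {a : ℤ → ℂ} (ha : MemSeq p a) :
    MemSeq q a := by
  have hle : ∀ n, ‖a n‖ₑ ≤ seqNorm p a := fun n => enorm_le_eLpNorm_count a n hp
  rcases eq_or_ne q ∞ with rfl | hq
  · rw [memSeq_iff, seqNorm, eLpNorm_exponent_top, eLpNormEssSup_count]
    exact (iSup_le hle).trans_lt ha.2
  have hpt : p ≠ ∞ := ne_top_of_le_ne_top hq hpq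
  have hq0 : q ≠ 0 := (lt_of_lt_of_le (pos_iff_ne_zero.2 hp) hpq).ne'
  have hp' := ENNReal.toReal_pos hp hpt
  have hpq' : p.toReal ≤ q.toReal := ENNReal.toReal_mono hq hpq
  rw [memSeq_iff, seqNorm_eq hq0 hq]
  refine ENNReal.rpow_lt_top_of_nonneg (by positivity) (ne_of_lt ?_)
  calc ∑' n, ‖a n‖ₑ ^ q.toReal
      ≤ ∑' n, seqNorm p a ^ (q.toReal - p.toReal) * ‖a n‖ₑ ^ p.toReal := by
        refine ENNReal.tsum_le_tsum fun n => ?_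
        have : q.toReal = (q.toReal - p.toReal) + p.toReal := by ring
        conv_lhs => rw [this, ENNReal.rpow_add_of_nonneg _ _ (by linarith) hp'.le]
        gcongr
        exact hle n
    _ < ∞ := by
        rw [ENNReal.tsum_mul_left, ← seqNorm_rpow hp hpt]
        exact ENNReal.mul_lt_top (ENNReal.rpow_lt_top_of_nonneg (by linarith) ha.2.ne)
          (ENNReal.rpow_lt_top_of_nonneg hp'.le ha.2.ne)

lemma half_add_ne (n : ℤ) : (n : ℝ) + 1 / 2 ≠ 0 := by
  intro h
  have h2 : ((2 * n + 1 : ℤ) : ℝ) = 0 := by push_cast; linarith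
  have : (2 * n + 1 : ℤ) = 0 := by exact_mod_cast h2
  omega

lemma summable_half_rpow {q : ℝ} (hq : 1 < q) :
    Summable (fun n : ℤ => |(n : ℝ) + 1 / 2| ^ (-q)) := by
  have := Real.summable_one_div_int_add_rpow (1/2) q
  have := this.2 hq
  refine this.congr fun n => ?_
  rw [Real.rpow_neg (abs_nonneg _), one_div]

/-- Decay of order one at infinity puts a kernel in every `ℓ^q` with `q > 1`. -/
lemma memSeq_of_decay {K : ℤ → ℂ} {C : ℝ} (hK : ∀ n : ℤ, ‖K n‖ ≤ C / |(n : ℝ) + 1 / 2|)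
    {q : ℝ≥0∞} (hq : 1 < q) : MemSeq q K := by
  have key : ∀ r : ℝ≥0∞, 1 < r → r ≠ ∞ → MemSeq r K := by
    intro r hr hrt
    have hr1 : 1 < r.toReal := by
      simpa using (ENNReal.toReal_lt_toReal ENNReal.one_ne_top hrt).2 hr
    rw [MemSeq, ← integrable_norm_rpow_iff AEStronglyMeasurable.of_discrete (by positivity) hrt,
      integrable_count_iff]
    have hC : 0 ≤ C := by
      have := (norm_nonneg _).trans (hK 0)
      by_contra hneg
      have : C / |((0 : ℤ) : ℝ) + 1 / 2| < 0 := div_neg_of_neg_of_pos (by linarith) (by norm_num)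
      linarith
    refine Summable.of_nonneg_of_le (fun n => norm_nonneg _) (fun n => ?_)
      ((summable_half_rpow hr1).mul_left (C ^ r.toReal))
    rw [Real.norm_of_nonneg (by positivity)]
    calc ‖K n‖ ^ r.toReal ≤ (C / |(n : ℝ) + 1 / 2|) ^ r.toReal := by gcongr; exact hK n
      _ = _ := by
        rw [Real.div_rpow hC (abs_nonneg _), Real.rpow_neg (abs_nonneg _), div_eq_mul_inv]
  rcases eq_or_ne q ∞ with rfl | hqt
  · exact (key 2 (by norm_num) (by norm_num)).mono (by norm_num) le_top
  · exact key q hq hqt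

lemma conv_eq_tsum_shift (K a : ℤ → ℂ) (n : ℤ) : conv K a n = ∑' k, K k * a (n - k) := by
  rw [conv, ← (Equiv.subLeft n).tsum_eq]
  simp

/-- Young's inequality `‖K * a‖_p ≤ ‖K‖₁ ‖a‖_p`, by Minkowski's inequality for the translates
of `a` and Fatou's lemma. -/
lemma seqNorm_conv_le {p : ℝ≥0∞} (hp : 1 ≤ p) {K a : ℤ → ℂ} (hK : MemSeq 1 K) (ha : MemSeq p a) :
    seqNorm p (conv K a) ≤ seqNorm 1 K * seqNorm p a := by
  have hainf : MemSeq ∞ a := ha.mono (by positivity) le_top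
  refine Lp.eLpNorm_le_of_ae_tendsto (u := atTop)
    (f := fun (s : Finset ℤ) n => ∑ k ∈ s, K k * a (n - k)) ?_
    (fun _ => AEStronglyMeasurable.of_discrete) ?_
  · refine Eventually.of_forall fun s => ?_
    have : (fun n => ∑ k ∈ s, K k * a (n - k)) = ∑ k ∈ s, K k • (fun n => a (n - k)) := by
      ext n; simp
    rw [this]
    refine (eLpNorm_sum_le (fun _ _ => AEStronglyMeasurable.of_discrete) hp).trans ?_
    calc ∑ k ∈ s, eLpNorm (K k • fun n => a (n - k)) p Measure.count
        = ∑ k ∈ s, ‖K k‖ₑ * seqNorm p a := by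
          refine Finset.sum_congr rfl fun k _ => ?_
          rw [eLpNorm_const_smul]
          congr 1
          exact seqNorm_comp_equiv p a (Equiv.subRight k)
      _ ≤ _ := by
          rw [← Finset.sum_mul, seqNorm_one]
          gcongr
          exact ENNReal.sum_le_tsum s
  · refine Eventually.of_forall fun n => ?_
    have h1 : Summable (fun m => K (n - m) * a m) := summable_conv hK hainf n
    rw [conv_eq_tsum_shift]
    have h2 : Summable (fun k => K k * a (n - k)) := by
      rw [← (Equiv.subLeft n).summable_iff]
      simpa [Function.comp_def] using h1
    exact h2.hasSum

lemma distrib_eq_count (b : ℤ → ℂ) (t : ℝ) :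
    distrib b t = Measure.count {n : ℤ | t < ‖b n‖} := by
  rw [distrib, Measure.count_apply (Set.to_countable _).measurableSet]

/-- Chebyshev's inequality. -/
lemma distrib_le_rpow {p : ℝ≥0∞} (h0 : p ≠ 0) (ht : p ≠ ∞) (b : ℤ → ℂ) {t : ℝ} (h : 0 < t) :
    distrib b t ≤ (seqNorm p b / ENNReal.ofReal t) ^ p.toReal := by
  rw [distrib_eq_count]
  have h1 := meas_ge_le_mul_pow_eLpNorm_enorm (Measure.count : Measure ℤ) h0 ht
    (f := b) AEStronglyMeasurable.of_discrete (ε := ENNReal.ofReal t) (by simpa using h) (by simp)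
  refine (measure_mono ?_).trans (h1.trans (le_of_eq ?_))
  · intro n hn
    rw [Set.mem_ofPred_eq, ← ofReal_norm]
    exact ENNReal.ofReal_le_ofReal (le_of_lt hn)
  · rw [← ENNReal.mul_rpow_of_nonneg _ _ ENNReal.toReal_nonneg, mul_comm, ← div_eq_mul_inv]
    rfl

lemma distrib_add_le (b c : ℤ → ℂ) (t : ℝ) :
    distrib (fun n => b n + c n) t ≤ distrib b (t / 2) + distrib c (t / 2) := by
  simp only [distrib_eq_count]
  refine (measure_mono ?_).trans (measure_union_le _ _)
  intro n hn
  simp only [Set.mem_ofPred_eq, Set.mem_union] at hn ⊢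
  by_contra! hcon
  have := norm_add_le (b n) (c n)
  linarith

/-! ### Weak type `(1,1)` of the Riesz–Titchmarsh transform -/

/-- Partial fractions of `∏ (1 + c / (x - s))` over a finite set of integers `s`: for `|c| ≤ 1`
the residues divided by `c` are nonnegative, and they add up to the number of poles. -/
lemma exists_partialFraction_weights {c : ℝ} (hc : |c| ≤ 1) (S : Finset ℤ) :
    ∃ v : ℤ → ℝ, (∀ s ∈ S, 0 ≤ v s) ∧ ∑ s ∈ S, v s = S.card ∧
      ∀ x : ℝ, (∀ s ∈ S, x ≠ s) →
        1 + c * ∑ s ∈ S, v s / (x - s) = ∏ s ∈ S, (1 + c / (x - s)) := by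
  classical
  have hpos : ∀ k : ℤ, k ≠ 0 → 0 ≤ 1 + c / (k : ℝ) := by
    intro k hk
    have h1 : (1 : ℝ) ≤ |(k : ℝ)| := by exact_mod_cast Int.one_le_abs hk
    have h2 : |c / (k : ℝ)| ≤ 1 := by
      rw [abs_div]; exact div_le_one_of_le₀ (hc.trans h1) (abs_nonneg _)
    linarith [neg_abs_le (c / (k : ℝ))]
  induction S using Finset.induction_on with
  | empty => exact ⟨0, by simp⟩
  | insert t S ht ih =>
    obtain ⟨v, hv0, hv1, hv2⟩ := ih
    have hts : ∀ s ∈ S, (t : ℝ) - s ≠ 0 := by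
      intro s hs h
      have : t = s := by exact_mod_cast sub_eq_zero.1 h
      exact ht (this ▸ hs)
    have hprod := hv2 t (fun s hs h => hts s hs (sub_eq_zero.2 h))
    -- the residue at an old pole picks up the new factor, the new residue is the old product
    let w : ℤ → ℝ := fun s => if s = t then 1 + c * ∑ r ∈ S, v r / (t - r) else
      v s * (1 + c / (s - t))
    have hwt : w t = 1 + c * ∑ r ∈ S, v r / (t - r) := if_pos rfl
    have hws : ∀ s ∈ S, w s = v s * (1 + c / (s - t)) := fun s hs =>
      if_neg (fun (h : s = t) => ht (h ▸ hs))
    refine ⟨w, ?_, ?_, ?_⟩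
    · intro s hs
      rcases Finset.mem_insert.1 hs with rfl | hs
      · rw [hwt, hprod]
        refine Finset.prod_nonneg fun r hr => ?_
        have := hpos (s - r) (sub_ne_zero.2 (fun h => ht (h ▸ hr)))
        push_cast at this
        exact this
      · rw [hws s hs]
        have := hpos (s - t) (sub_ne_zero.2 (fun h => ht (h ▸ hs)))
        push_cast at this
        exact mul_nonneg (hv0 s hs) this
    · rw [Finset.sum_insert ht, Finset.card_insert_of_notMem ht, hwt, Finset.sum_congr rfl hws]
      push_cast
      rw [← hv1, Finset.mul_sum, add_assoc, ← Finset.sum_add_distrib, add_comm]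
      congr 1
      refine Finset.sum_congr rfl fun s hs => ?_
      have h1 := hts s hs
      have h2 : (s : ℝ) - t ≠ 0 := by rw [← neg_sub]; exact neg_ne_zero.2 h1
      rw [show (t : ℝ) - s = -(s - t) by ring]
      field_simp
      ring
    · intro x hx
      have hxt : x - t ≠ 0 := sub_ne_zero.2 (hx t (Finset.mem_insert_self _ _))
      have hxs : ∀ s ∈ S, x - s ≠ 0 := fun s hs =>
        sub_ne_zero.2 (hx s (Finset.mem_insert_of_mem hs))
      rw [Finset.prod_insert ht,
        ← hv2 x (fun s hs => hx s (Finset.mem_insert_of_mem hs)), Finset.sum_insert ht, hwt]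
      have key : ∀ s ∈ S, w s / (x - s) =
          (1 + c / (x - t)) * (v s / (x - s)) - c / (x - t) * (v s / (t - s)) := by
        intro s hs
        have h1 := hts s hs
        have h2 : (s : ℝ) - t ≠ 0 := by rw [← neg_sub]; exact neg_ne_zero.2 h1
        have h3 := hxs s hs
        rw [hws s hs, show (t : ℝ) - s = -(s - t) by ring]
        field_simp
        ring
      rw [Finset.sum_congr rfl key, Finset.sum_sub_distrib, ← Finset.mul_sum, ← Finset.mul_sum]
      field_simp
      ring

/-- A discrete form of Loomis's lemma: `±∑ₘ bₘ / (n + 1/2 - m) ≥ t` can hold on at most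
`2 ‖b‖₁ / t` integers `n`. Averaging against the weights of `exists_partialFraction_weights`, with
`c = ±1/2`, replaces the singular kernel by `1 - ∏ (1 + c / (m - 1/2 - s))`, which is at most `1`
since all factors are nonnegative at integers `m`. -/
lemma card_mul_le_of_half_kernel {c : ℝ} (hc : c = 1 / 2 ∨ c = -(1 / 2)) {b : ℤ → ℝ}
    (hb0 : ∀ m, 0 ≤ b m) (hb : Summable b) {t : ℝ} (S : Finset ℤ)
    (hS : ∀ n ∈ S, t ≤ 2 * c * ∑' m : ℤ, b m / ((n : ℝ) - m + 1 / 2)) :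
    t * S.card ≤ 2 * ∑' m, b m := by
  have hcle : |c| ≤ 1 := by
    rcases hc with rfl | rfl
    · rw [abs_of_nonneg] <;> norm_num
    · rw [abs_neg, abs_of_nonneg] <;> norm_num
  obtain ⟨v, hv0, hv1, hv2⟩ := exists_partialFraction_weights hcle S
  have hsum : ∀ n : ℤ, Summable (fun m : ℤ => b m / ((n : ℝ) - m + 1 / 2)) := by
    intro n
    refine Summable.of_norm_bounded (g := fun m => 2 * b m) (hb.mul_left 2) fun m => ?_
    have h1 : (1 / 2 : ℝ) ≤ |(n : ℝ) - m + 1 / 2| := by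
      have : (1 : ℝ) ≤ |((2 * (n - m) + 1 : ℤ) : ℝ)| := by
        exact_mod_cast Int.one_le_abs (by omega)
      have h2 : ((2 * (n - m) + 1 : ℤ) : ℝ) = 2 * ((n : ℝ) - m + 1 / 2) := by push_cast; ring
      rw [h2, abs_mul, abs_two] at this
      linarith
    rw [Real.norm_eq_abs, abs_div, abs_of_nonneg (hb0 m), div_le_iff₀ (by linarith)]
    nlinarith [hb0 m]
  calc t * S.card = ∑ n ∈ S, v n * t := by rw [← Finset.sum_mul, hv1, mul_comm]
    _ ≤ ∑ n ∈ S, v n * (2 * c * ∑' m : ℤ, b m / ((n : ℝ) - m + 1 / 2)) :=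
        Finset.sum_le_sum fun n hn => mul_le_mul_of_nonneg_left (hS n hn) (hv0 n hn)
    _ = ∑' m : ℤ, ∑ n ∈ S, v n * (2 * c * (b m / ((n : ℝ) - m + 1 / 2))) := by
        rw [Summable.tsum_finsetSum]
        · simp_rw [tsum_mul_left]
        · exact fun n _ => ((hsum n).mul_left _).mul_left _
    _ ≤ ∑' m, 2 * b m := by
        refine Summable.tsum_le_tsum (fun m => ?_)
          (summable_sum fun n _ => ((hsum n).mul_left _).mul_left _) (hb.mul_left 2)
        have hne : ∀ n ∈ S, ((m : ℝ) - 1 / 2) ≠ n := by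
          intro n _ h
          exact half_add_ne (n - m) (by push_cast; linarith)
        have hid := hv2 ((m : ℝ) - 1 / 2) hne
        -- each factor is `(m - 1/2 - n + c) / (m - 1/2 - n)`, whose numerator is the integer
        -- `m - n` or `m - n - 1`
        have hprod : 0 ≤ ∏ n ∈ S, (1 + c / ((m : ℝ) - 1 / 2 - n)) := by
          refine Finset.prod_nonneg fun n hn => ?_
          have hx : (m : ℝ) - 1 / 2 - n ≠ 0 := sub_ne_zero.2 (hne n hn)
          rw [one_add_div hx]
          rcases le_or_gt m n with h | h
          · have : (m : ℝ) ≤ n := by exact_mod_cast h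
            exact div_nonneg_of_nonpos (by rcases hc with rfl | rfl <;> linarith) (by linarith)
          · have : (n : ℝ) + 1 ≤ m := by exact_mod_cast h
            exact div_nonneg (by rcases hc with rfl | rfl <;> linarith) (by linarith)
        have hre : ∑ n ∈ S, v n * (2 * c * (b m / ((n : ℝ) - m + 1 / 2))) =
            2 * b m * (-(c * ∑ n ∈ S, v n / ((m : ℝ) - 1 / 2 - n))) := by
          rw [Finset.mul_sum, ← Finset.sum_neg_distrib, Finset.mul_sum]
          refine Finset.sum_congr rfl fun n _ => ?_
          rw [show (m : ℝ) - 1 / 2 - n = -((n : ℝ) - m + 1 / 2) by ring, div_neg]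
          ring
        rw [hre]
        have : -(c * ∑ n ∈ S, v n / ((m : ℝ) - 1 / 2 - n)) ≤ 1 := by linarith
        nlinarith [hb0 m]
    _ = 2 * ∑' m, b m := tsum_mul_left

lemma count_le_of_forall_finset {A : Set ℤ} {M : ℝ≥0∞}
    (h : ∀ S : Finset ℤ, (S : Set ℤ) ⊆ A → (S.card : ℝ≥0∞) ≤ M) :
    Measure.count A ≤ M := by
  by_cases hA : A.Finite
  · rw [Measure.count_apply_finite A hA]
    exact h _ (by simp)
  · have : M = ∞ := by
      refine ENNReal.eq_top_of_forall_nnreal_le fun r => ?_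
      obtain ⟨k, hk⟩ := exists_nat_ge r
      obtain ⟨S, hS, hc⟩ := Set.Infinite.exists_subset_card_eq hA k
      refine le_trans ?_ (h S hS)
      rw [hc]
      exact_mod_cast hk
    simp [this]

lemma norm_kernelHplus (n : ℤ) : ‖kernelHplus n‖ = (1 / Real.pi) / |(n : ℝ) + 1 / 2| := by
  have : kernelHplus n = ((1 / (Real.pi * ((n : ℝ) + 1 / 2)) : ℝ) : ℂ) := by
    simp [kernelHplus]
  rw [this, Complex.norm_real, Real.norm_eq_abs, abs_div, abs_mul, abs_one,
    abs_of_pos Real.pi_pos, div_div]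

lemma memSeq_kernelHplus {q : ℝ≥0∞} (hq : 1 < q) : MemSeq q kernelHplus :=
  memSeq_of_decay (fun n => (norm_kernelHplus n).le) hq

lemma Hplus_ofReal (b : ℤ → ℝ) (n : ℤ) : Hplus (fun m => (b m : ℂ)) n =
    ((1 / Real.pi * ∑' m : ℤ, b m / ((n : ℝ) - m + 1 / 2) : ℝ) : ℂ) := by
  rw [Hplus, conv, ← tsum_mul_left, Complex.ofReal_tsum]
  refine tsum_congr fun m => ?_
  simp only [kernelHplus]
  push_cast
  rw [one_div, mul_inv, one_div]
  ring

lemma distrib_Hplus_ofReal_le {b : ℤ → ℝ} (hb0 : ∀ m, 0 ≤ b m) (hb : Summable b) {t : ℝ}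
    (ht : 0 < t) :
    distrib (Hplus (fun m => (b m : ℂ))) t ≤ ENNReal.ofReal (4 * ∑' m, b m) / ENNReal.ofReal t := by
  rw [distrib_eq_count]
  refine count_le_of_forall_finset fun S hS => ?_
  rw [← ENNReal.ofReal_div_of_pos ht, ← ENNReal.ofReal_natCast]
  refine ENNReal.ofReal_le_ofReal ?_
  rw [le_div_iff₀ ht]
  have hF : ∀ n ∈ S, t ≤ |∑' m : ℤ, b m / ((n : ℝ) - m + 1 / 2)| := by
    intro n hn
    have h1 := hS hn
    rw [Set.mem_ofPred_eq, Hplus_ofReal, Complex.norm_real, Real.norm_eq_abs, abs_mul] at h1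
    refine h1.le.trans (mul_le_of_le_one_left (abs_nonneg _) ?_)
    rw [abs_of_pos (by positivity), div_le_one Real.pi_pos]
    linarith [Real.pi_gt_three]
  classical
  have h1 := card_mul_le_of_half_kernel (Or.inl rfl) hb0 hb (t := t)
    (S.filter fun n : ℤ => 0 ≤ ∑' m : ℤ, b m / ((n : ℝ) - m + 1 / 2)) (by
      intro n hn
      obtain ⟨hn, h0⟩ := Finset.mem_filter.1 hn
      have := hF n hn
      rw [abs_of_nonneg h0] at this
      linarith)
  have h2 := card_mul_le_of_half_kernel (Or.inr rfl) hb0 hb (t := t)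
    (S.filter fun n : ℤ => ¬ 0 ≤ ∑' m : ℤ, b m / ((n : ℝ) - m + 1 / 2)) (by
      intro n hn
      obtain ⟨hn, h0⟩ := Finset.mem_filter.1 hn
      have := hF n hn
      rw [abs_of_neg (not_le.1 h0)] at this
      linarith)
  have h3 := Finset.card_filter_add_card_filter_not (s := S)
    (fun n : ℤ => 0 ≤ ∑' m : ℤ, b m / ((n : ℝ) - m + 1 / 2))
  rw [← h3]
  push_cast
  linarith

lemma conv_add {K a b : ℤ → ℂ} {n : ℤ} (ha : Summable fun m => K (n - m) * a m)
    (hb : Summable fun m => K (n - m) * b m) :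
    conv K (fun m => a m + b m) n = conv K a n + conv K b n := by
  rw [conv, conv, conv, ← ha.tsum_add hb]
  exact tsum_congr fun m => mul_add _ _ _

lemma conv_const_mul (K a : ℤ → ℂ) (c : ℂ) (n : ℤ) :
    conv K (fun m => c * a m) n = c * conv K a n := by
  rw [conv, conv, ← tsum_mul_left]
  exact tsum_congr fun m => by ring

lemma distrib_const_mul {c : ℂ} (hc : ‖c‖ = 1) (b : ℤ → ℂ) (t : ℝ) :
    distrib (fun n => c * b n) t = distrib b t := by
  simp [distrib, hc]

/-- The constant is `4 · 16`: four nonnegative parts of the sequence, each used at height `t / 4` in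
`distrib_Hplus_ofReal_le`. -/
lemma weakType_Hplus : WeakType11With 64 Hplus := by
  intro a ha t ht
  have hsum : Summable a := memSeq_one_iff.1 ha
  have part : ∀ (c : ℂ) (b : ℤ → ℝ), ‖c‖ = 1 → (∀ m, 0 ≤ b m) → (∀ m, b m ≤ ‖a m‖) →
      distrib (Hplus (fun m => c * (b m : ℂ))) (t / 2 / 2) ≤
        16 * (seqNorm 1 a / ENNReal.ofReal t) := by
    intro c b hc hb0 hb
    have hbs : Summable b := Summable.of_nonneg_of_le hb0 hb hsum.norm
    have h1 : Hplus (fun m => c * (b m : ℂ)) = fun n => c * Hplus (fun m => (b m : ℂ)) n :=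
      funext fun n => conv_const_mul _ _ _ _
    rw [h1, distrib_const_mul hc]
    refine (distrib_Hplus_ofReal_le hb0 hbs (by positivity)).trans ?_
    have h2 : seqNorm 1 a = ENNReal.ofReal (∑' m, ‖a m‖) := by
      rw [seqNorm_one, ENNReal.ofReal_tsum_of_nonneg (fun _ => norm_nonneg _) hsum.norm]
      simp_rw [ofReal_norm]
    rw [h2, ← ENNReal.ofReal_div_of_pos ht, ← ENNReal.ofReal_div_of_pos (by positivity),
      show (16 : ℝ≥0∞) = ENNReal.ofReal 16 by simp, ← ENNReal.ofReal_mul (by norm_num)]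
    refine ENNReal.ofReal_le_ofReal ?_
    have h3 := Summable.tsum_le_tsum hb hbs hsum.norm
    rw [div_le_iff₀ (by positivity)]
    calc 4 * ∑' m, b m ≤ 4 * ∑' m, ‖a m‖ := by linarith
      _ = _ := by ring_nf; field_simp
  have hms : ∀ (c : ℂ) (b : ℤ → ℝ), ‖c‖ = 1 → (∀ m, 0 ≤ b m) → (∀ m, b m ≤ ‖a m‖) → ∀ n : ℤ,
      Summable fun m => kernelHplus (n - m) * (c * (b m : ℂ)) := by
    intro c b hc hb0 hb n
    refine summable_conv (p := ∞) (q := 1) (memSeq_kernelHplus (by simp)) ?_ n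
    rw [memSeq_one_iff]
    refine Summable.of_norm_bounded hsum.norm fun m => ?_
    rw [norm_mul, hc, one_mul, Complex.norm_real, Real.norm_of_nonneg (hb0 m)]
    exact hb m
  -- positive and negative parts of the real and imaginary parts
  have e : a = fun m => ((1 * ((max (a m).re 0 : ℝ) : ℂ)) + (-1) * ((max (-(a m).re) 0 : ℝ) : ℂ)) +
      (Complex.I * ((max (a m).im 0 : ℝ) : ℂ) + (-Complex.I) * ((max (-(a m).im) 0 : ℝ) : ℂ)) := by
    funext m
    have h1 : ∀ x : ℝ, max x 0 - max (-x) 0 = x := fun x => by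
      rcases le_total x 0 with h | h <;> simp [h]
    apply Complex.ext
    · simpa [sub_eq_add_neg] using (h1 (a m).re).symm
    · simpa [sub_eq_add_neg] using (h1 (a m).im).symm
  have hre : ∀ m, |(a m).re| ≤ ‖a m‖ := fun m => Complex.abs_re_le_norm _
  have him : ∀ m, |(a m).im| ≤ ‖a m‖ := fun m => Complex.abs_im_le_norm _
  have b1 : ∀ m, max (a m).re 0 ≤ ‖a m‖ := fun m =>
    max_le ((le_abs_self _).trans (hre m)) (norm_nonneg _)
  have b2 : ∀ m, max (-(a m).re) 0 ≤ ‖a m‖ := fun m =>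
    max_le ((neg_le_abs _).trans (hre m)) (norm_nonneg _)
  have b3 : ∀ m, max (a m).im 0 ≤ ‖a m‖ := fun m =>
    max_le ((le_abs_self _).trans (him m)) (norm_nonneg _)
  have b4 : ∀ m, max (-(a m).im) 0 ≤ ‖a m‖ := fun m =>
    max_le ((neg_le_abs _).trans (him m)) (norm_nonneg _)
  have n1 : ∀ m, 0 ≤ max (a m).re 0 := fun m => le_max_right _ _
  have n2 : ∀ m, 0 ≤ max (-(a m).re) 0 := fun m => le_max_right _ _
  have n3 : ∀ m, 0 ≤ max (a m).im 0 := fun m => le_max_right _ _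
  have n4 : ∀ m, 0 ≤ max (-(a m).im) 0 := fun m => le_max_right _ _
  have split : Hplus a = fun n =>
      (Hplus (fun m => 1 * ((max (a m).re 0 : ℝ) : ℂ)) n +
        Hplus (fun m => (-1) * ((max (-(a m).re) 0 : ℝ) : ℂ)) n) +
      (Hplus (fun m => Complex.I * ((max (a m).im 0 : ℝ) : ℂ)) n +
        Hplus (fun m => (-Complex.I) * ((max (-(a m).im) 0 : ℝ) : ℂ)) n) := by
    funext n
    have s1 := hms 1 _ (by simp) n1 b1 n
    have s2 := hms (-1) _ (by simp) n2 b2 n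
    have s3 := hms Complex.I _ (by simp) n3 b3 n
    have s4 := hms (-Complex.I) _ (by simp) n4 b4 n
    conv_lhs => rw [e]
    simp only [Hplus]
    rw [conv_add, conv_add s1 s2, conv_add s3 s4]
    · exact (s1.add s2).congr fun m => (mul_add _ _ _).symm
    · exact (s3.add s4).congr fun m => (mul_add _ _ _).symm
  rw [split]
  refine (distrib_add_le _ _ _).trans ?_
  refine (add_le_add (distrib_add_le _ _ _) (distrib_add_le _ _ _)).trans ?_
  refine (add_le_add (add_le_add (part 1 _ (by simp) n1 b1) (part (-1) _ (by simp) n2 b2))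
    (add_le_add (part Complex.I _ (by simp) n3 b3) (part (-Complex.I) _ (by simp) n4 b4))).trans ?_
  refine le_of_eq ?_
  rw [mul_div_assoc]
  push_cast
  ring

/-! ### Convolution operators as Fourier multipliers -/

/-- Polarized Parseval identity on an interval. -/
lemma hasSum_conj_fourierCoeffOn_mul {a b : ℝ} {f g : ℝ → ℂ} (hab : a < b)
    (hf : MemLp f 2 (volume.restrict (Set.Ioc a b)))
    (hg : MemLp g 2 (volume.restrict (Set.Ioc a b))) :
    HasSum (fun i => conj (fourierCoeffOn hab f i) * fourierCoeffOn hab g i)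
      ((b - a)⁻¹ • ∫ x in a..b, conj (f x) * g x) := by
  have := Fact.mk (by linarith : 0 < b - a)
  rw [← add_sub_cancel a b] at hf hg
  have hf' := hf.memLp_liftIoc.haarAddCircle
  have hg' := hg.memLp_liftIoc.haarAddCircle
  have h := (fourierBasis (T := b - a)).hasSum_inner_mul_inner hf'.toLp hg'.toLp
  have c : ∀ {u : ℝ → ℂ} (hu : MemLp (liftIoc (b - a) a u) 2 haarAddCircle) (i : ℤ),
      inner ℂ ((fourierBasis (T := b - a)) i) hu.toLp = fourierCoeffOn hab u i := by
    intro u hu i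
    rw [← HilbertBasis.repr_apply_apply, fourierBasis_repr, fourierCoeff_congr_ae hu.coeFn_toLp]
    rfl
  have e1 : ∀ i, inner ℂ hf'.toLp ((fourierBasis (T := b - a)) i) *
      inner ℂ ((fourierBasis (T := b - a)) i) hg'.toLp =
        conj (fourierCoeffOn hab f i) * fourierCoeffOn hab g i := fun i => by
    rw [c hg', ← inner_conj_symm, c hf']
  have e2 : inner ℂ hf'.toLp hg'.toLp = (b - a)⁻¹ • ∫ x in a..b, conj (f x) * g x := by
    have e3 : ∫ x in a..b, conj (f x) * g x = ∫ x in a..(a + (b - a)), conj (f x) * g x := by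
      rw [add_sub_cancel]
    rw [MeasureTheory.L2.inner_def, e3, ← AddCircle.integral_liftIoc_eq_intervalIntegral,
      ← AddCircle.integral_haarAddCircle]
    apply integral_congr_ae
    filter_upwards [hf'.coeFn_toLp, hg'.coeFn_toLp] with x hx hy
    rw [hx, hy, RCLike.inner_apply', liftIoc, liftIoc, liftIoc]
    simp [Function.comp]
  simp_rw [e1] at h
  rw [e2] at h
  exact h

lemma neg_pi_lt_pi : -Real.pi < Real.pi := by linarith [Real.pi_pos]

lemma invFourier_eq_fourierCoeffOn (g : ℝ → ℂ) (n : ℤ) :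
    invFourier g n = fourierCoeffOn neg_pi_lt_pi g (-n) := by
  rw [fourierCoeffOn_eq_integral, invFourier, Complex.real_smul]
  congr 1
  · push_cast; ring
  · refine intervalIntegral.integral_congr fun θ _ => ?_
    simp only [neg_neg, smul_eq_mul]
    rw [fourier_coe_apply, mul_comm]
    congr 2
    have : (Real.pi : ℂ) ≠ 0 := by exact_mod_cast Real.pi_ne_zero
    push_cast
    field_simp
    ring

lemma norm_exp_I_mul (x : ℝ) : ‖Complex.exp (Complex.I * x)‖ = 1 := by
  rw [mul_comm]; exact Complex.norm_exp_ofReal_mul_I x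

lemma norm_exp_I_intCast_mul (n : ℤ) (θ : ℝ) :
    ‖Complex.exp (Complex.I * (n : ℂ) * (θ : ℂ))‖ = 1 := by
  rw [show Complex.I * (n : ℂ) * (θ : ℂ) = Complex.I * ((n * θ : ℝ) : ℂ) by push_cast; ring]
  exact norm_exp_I_mul _

/-- Parseval's identity for `𝓕⁻¹`. -/
lemma tsum_norm_sq_invFourier {g : ℝ → ℂ}
    (hg : MemLp g 2 (volume.restrict (Set.Ioc (-Real.pi) Real.pi))) :
    HasSum (fun n => ‖invFourier g n‖ ^ 2)
      ((Real.pi - -Real.pi)⁻¹ • ∫ x in (-Real.pi)..Real.pi, ‖g x‖ ^ 2) := by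
  simp_rw [invFourier_eq_fourierCoeffOn]
  exact (Equiv.neg ℤ).hasSum_iff.2 (hasSum_sq_fourierCoeffOn neg_pi_lt_pi hg)

/-- For a bounded multiplier `m` and `g ∈ L²`, convolution of the Fourier coefficients is given
by multiplication of the functions. -/
lemma conv_invFourier {m g : ℝ → ℂ} (hm : MemLp m ∞ (volume.restrict (Set.Ioc (-Real.pi) Real.pi)))
    (hg : MemLp g 2 (volume.restrict (Set.Ioc (-Real.pi) Real.pi))) (n : ℤ) :
    conv (invFourier m) (invFourier g) n = invFourier (fun θ => m θ * g θ) n := by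
  let f : ℝ → ℂ := fun θ => conj (m θ * Complex.exp (Complex.I * (n : ℂ) * (θ : ℂ)))
  have hexp : Continuous fun θ : ℝ => Complex.exp (Complex.I * (n : ℂ) * (θ : ℂ)) := by fun_prop
  have hf : MemLp f 2 (volume.restrict (Set.Ioc (-Real.pi) Real.pi)) := by
    have h2 : MemLp m 2 (volume.restrict (Set.Ioc (-Real.pi) Real.pi)) := hm.mono_exponent le_top
    refine h2.of_le ?_ (Eventually.of_forall fun θ => ?_)
    · exact Complex.continuous_conj.comp_aestronglyMeasurable
        (h2.1.mul hexp.aestronglyMeasurable)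
    · simp only [f]
      rw [RCLike.norm_conj, norm_mul, norm_exp_I_intCast_mul, mul_one]
  have h := hasSum_conj_fourierCoeffOn_mul neg_pi_lt_pi hf hg
  have hcoef : ∀ i : ℤ, conj (fourierCoeffOn neg_pi_lt_pi f i) = invFourier m (n + i) := by
    intro i
    have h1 := invFourier_eq_fourierCoeffOn f (-i)
    rw [neg_neg] at h1
    rw [← h1, invFourier, invFourier, map_mul]
    congr 1
    · simp [map_ofNat (starRingEnd ℂ) 2]
    · rw [intervalIntegral.integral_of_le neg_pi_lt_pi.le,
        intervalIntegral.integral_of_le neg_pi_lt_pi.le, ← integral_conj]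
      refine integral_congr_ae (Eventually.of_forall fun θ => ?_)
      simp only [f, map_mul, Complex.conj_conj, ← Complex.exp_conj, Complex.conj_I,
        Complex.conj_ofReal, map_intCast, map_neg, neg_neg]
      rw [mul_assoc, ← Complex.exp_add]
      congr 2
      push_cast
      ring
  have h3 : conv (invFourier m) (invFourier g) n =
      ∑' i, conj (fourierCoeffOn neg_pi_lt_pi f i) * fourierCoeffOn neg_pi_lt_pi g i := by
    rw [conv, ← (Equiv.neg ℤ).tsum_eq]
    refine tsum_congr fun i => ?_
    rw [hcoef, invFourier_eq_fourierCoeffOn g]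
    simp
  rw [h3, h.tsum_eq, invFourier, Complex.real_smul]
  congr 1
  · push_cast; ring
  · refine intervalIntegral.integral_congr fun θ _ => ?_
    simp only [f, Complex.conj_conj]
    ring

/-- Riesz–Fischer for `𝓕⁻¹`. -/
lemma exists_invFourier_eq {a : ℤ → ℂ} (ha : MemSeq 2 a) :
    ∃ g : ℝ → ℂ, MemLp g 2 (volume.restrict (Set.Ioc (-Real.pi) Real.pi)) ∧ invFourier g = a := by
  have := Fact.mk (by linarith [Real.pi_pos] : 0 < Real.pi - -Real.pi)
  have hl : Memℓp (fun n : ℤ => a (-n)) 2 := by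
    have h1 := (ha.comp_equiv (Equiv.neg ℤ))
    refine memℓp_gen ?_
    have h2 := (integrable_norm_rpow_iff h1.1 (by norm_num) (by norm_num)).2 h1
    rw [integrable_count_iff] at h2
    simpa using h2
  let G : Lp ℂ 2 (haarAddCircle (T := Real.pi - -Real.pi)) := fourierBasis.repr.symm ⟨_, hl⟩
  have hG : ∀ i : ℤ, fourierCoeff (T := Real.pi - -Real.pi) G i = a (-i) := by
    intro i
    rw [← fourierBasis_repr]
    simp [G]
  refine ⟨fun θ => G (θ : AddCircle (Real.pi - -Real.pi)), ?_, ?_⟩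
  · have h1 : MemLp (G : AddCircle (Real.pi - -Real.pi) → ℂ) 2 volume :=
      (Lp.memLp G).of_haarAddCircle
    have h2 := AddCircle.measurePreserving_mk (Real.pi - -Real.pi) (-Real.pi)
    rw [show -Real.pi + (Real.pi - -Real.pi) = Real.pi by ring] at h2
    exact h1.comp_measurePreserving h2
  · funext n
    rw [invFourier_eq_fourierCoeffOn, fourierCoeffOn_eq_integral]
    have h1 := fourierCoeff_eq_intervalIntegral (T := Real.pi - -Real.pi) G (-n) (-Real.pi)
    rw [hG, neg_neg, show -Real.pi + (Real.pi - -Real.pi) = Real.pi by ring] at h1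
    rw [h1, neg_neg]

/-- On `ℓ¹` the multiplier identity is an interchange of sum and integral. -/
lemma conv_invFourier_of_summable {m : ℝ → ℂ}
    (hm : MemLp m ∞ (volume.restrict (Set.Ioc (-Real.pi) Real.pi))) {a : ℤ → ℂ}
    (ha : Summable a) (n : ℤ) :
    conv (invFourier m) a n = invFourier (fun θ => m θ * fourierSeq a θ) n := by
  have hmi : Integrable m (volume.restrict (Set.Ioc (-Real.pi) Real.pi)) :=
    hm.integrable le_top
  have hexp : ∀ k : ℤ, Continuous fun θ : ℝ => Complex.exp (Complex.I * (k : ℂ) * (θ : ℂ)) :=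
    fun k => by fun_prop
  let F : ℤ → ℝ → ℂ := fun k θ =>
    a k * (m θ * Complex.exp (Complex.I * ((n - k : ℤ) : ℂ) * (θ : ℂ)))
  have hF : ∀ k, Integrable (F k) (volume.restrict (Set.Ioc (-Real.pi) Real.pi)) := by
    intro k
    refine Integrable.const_mul ?_ _
    exact hmi.mul_bdd (c := 1) (hexp _).aestronglyMeasurable
      (Eventually.of_forall fun θ => (norm_exp_I_intCast_mul _ θ).le)
  have hFn : ∀ k, ∫ θ in Set.Ioc (-Real.pi) Real.pi, ‖F k θ‖ =
      ‖a k‖ * ∫ θ in Set.Ioc (-Real.pi) Real.pi, ‖m θ‖ := by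
    intro k
    simp only [F, norm_mul, norm_exp_I_intCast_mul, mul_one]
    rw [integral_const_mul]
  have h := hasSum_integral_of_summable_integral_norm hF (by
    simp_rw [hFn]
    exact ha.norm.mul_right _)
  have h1 : conv (invFourier m) a n = (1 / (2 * (Real.pi : ℂ))) *
      ∑' k, ∫ θ in Set.Ioc (-Real.pi) Real.pi, F k θ := by
    rw [conv, ← tsum_mul_left]
    refine tsum_congr fun k => ?_
    simp only [F]
    rw [integral_const_mul, invFourier, intervalIntegral.integral_of_le neg_pi_lt_pi.le]
    ring
  rw [h1, h.tsum_eq, invFourier, intervalIntegral.integral_of_le neg_pi_lt_pi.le]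
  congr 1
  refine integral_congr_ae (Eventually.of_forall fun θ => ?_)
  simp only [F, fourierSeq]
  rw [mul_assoc, mul_comm (∑' _, _) (Complex.exp _), ← mul_assoc, ← tsum_mul_left]
  refine tsum_congr fun k => ?_
  have : Complex.exp (Complex.I * ((n - k : ℤ) : ℂ) * (θ : ℂ)) =
      Complex.exp (Complex.I * (n : ℂ) * (θ : ℂ)) *
        Complex.exp (-(Complex.I * (k : ℂ) * (θ : ℂ))) := by
    rw [← Complex.exp_add]
    congr 1
    push_cast
    ring
  rw [this]
  ring

/-- A multiplier bounded by `1` is a contraction on `ℓ²`. -/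
lemma seqNorm_two_conv_invFourier_le {m : ℝ → ℂ}
    (hm : AEStronglyMeasurable m (volume.restrict (Set.Ioc (-Real.pi) Real.pi)))
    (hm1 : ∀ θ, ‖m θ‖ ≤ 1) {a : ℤ → ℂ} (ha : MemSeq 2 a) :
    seqNorm 2 (conv (invFourier m) a) ≤ seqNorm 2 a := by
  have hmb : MemLp m ∞ (volume.restrict (Set.Ioc (-Real.pi) Real.pi)) :=
    memLp_top_of_bound hm 1 (Eventually.of_forall hm1)
  obtain ⟨g, hg, rfl⟩ := exists_invFourier_eq ha
  have hmg : MemLp (fun θ => m θ * g θ) 2 (volume.restrict (Set.Ioc (-Real.pi) Real.pi)) :=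
    hg.of_le (hm.mul hg.1) (Eventually.of_forall fun θ => by
      rw [norm_mul]; exact mul_le_of_le_one_left (norm_nonneg _) (hm1 θ))
  rw [show conv (invFourier m) (invFourier g) = invFourier (fun θ => m θ * g θ) from
    funext fun n => conv_invFourier hmb hg n]
  have h1 := tsum_norm_sq_invFourier hmg
  have h2 := tsum_norm_sq_invFourier hg
  have e : ∀ b : ℤ → ℂ, Summable (fun n => ‖b n‖ ^ 2) →
      seqNorm 2 b = ENNReal.ofReal (∑' n, ‖b n‖ ^ 2) ^ (1 / 2 : ℝ) := by
    intro b hb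
    rw [seqNorm_eq (by norm_num) (by norm_num),
      ENNReal.ofReal_tsum_of_nonneg (fun _ => by positivity) hb]
    simp [ENNReal.ofReal_pow]
  rw [e _ h1.summable, e _ h2.summable, h1.tsum_eq, h2.tsum_eq]
  gcongr
  · rw [inv_nonneg]
    linarith [Real.pi_pos]
  · rw [intervalIntegral.integral_of_le neg_pi_lt_pi.le,
        intervalIntegral.integral_of_le neg_pi_lt_pi.le]
    refine integral_mono hmg.norm.integrable_sq hg.norm.integrable_sq fun θ => ?_
    simp only [norm_mul]
    gcongr
    exact mul_le_of_le_one_left (norm_nonneg _) (hm1 θ)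

/-! ### The kernels `K_d` and `D` -/

/-- The smooth function that equals `ρ^{1/2}` on `[0, π]`. -/
noncomputable def sqrtRhoExt (θ : ℝ) : ℝ :=
  Real.sqrt (1 + Real.sin (θ / 2) ^ 2) - Real.sin (θ / 2)

lemma sqrt_rho (θ : ℝ) : Real.sqrt (rho θ) =
    Real.sqrt (1 + Real.sin (θ / 2) ^ 2) - |Real.sin (θ / 2)| := by
  set s := |Real.sin (θ / 2)| with hs
  have hs0 : 0 ≤ s := abs_nonneg _
  have hss : Real.sin (θ / 2) ^ 2 = s ^ 2 := (sq_abs _).symm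
  have hcos : Real.cos θ = 1 - 2 * s ^ 2 := by
    rw [← hss, ← Real.cos_sq_add_sin_sq (θ / 2)]
    have := Real.cos_two_mul (θ / 2)
    rw [show 2 * (θ / 2) = θ by ring] at this
    nlinarith [Real.cos_sq_add_sin_sq (θ / 2)]
  set r := Real.sqrt (1 + s ^ 2) with hr
  have hr0 : 0 ≤ r := Real.sqrt_nonneg _
  have hr2 : r ^ 2 = 1 + s ^ 2 := Real.sq_sqrt (by positivity)
  have h1 : Real.sqrt ((2 - Real.cos θ) ^ 2 - 1) = 2 * s * r := by
    rw [hcos, show (2 - (1 - 2 * s ^ 2)) ^ 2 - 1 = (2 * s * r) ^ 2 by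
      rw [mul_pow, hr2]; ring]
    exact Real.sqrt_sq (by positivity)
  have h2 : rho θ = (r - s) ^ 2 := by
    rw [rho, h1, hcos]
    linear_combination -hr2
  rw [hss, h2, Real.sqrt_sq]
  have : s ≤ r := Real.le_sqrt_of_sq_le (by linarith)
  linarith

lemma sqrt_rho_eq {θ : ℝ} (h0 : 0 ≤ θ) (hp : θ ≤ Real.pi) :
    Real.sqrt (rho θ) = sqrtRhoExt θ := by
  rw [sqrt_rho, sqrtRhoExt, abs_of_nonneg]
  exact Real.sin_nonneg_of_nonneg_of_le_pi (by linarith) (by linarith)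

lemma rho_neg (θ : ℝ) : rho (-θ) = rho θ := by simp [rho]

lemma sqrt_rho_le_one (θ : ℝ) : Real.sqrt (rho θ) ≤ 1 := by
  rw [sqrt_rho, sub_le_iff_le_add, Real.sqrt_le_left (by positivity)]
  nlinarith [sq_abs (Real.sin (θ / 2)), abs_nonneg (Real.sin (θ / 2))]

lemma norm_multiplier_le (θ : ℝ) : ‖multiplier θ‖ ≤ 1 := by
  have h1 : ‖Complex.exp (Complex.I * (θ : ℂ) / 2)‖ = 1 := by
    rw [show Complex.I * (θ : ℂ) / 2 = Complex.I * ((θ / 2 : ℝ) : ℂ) by push_cast; ring]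
    exact norm_exp_I_mul _
  have h2 : |Real.sign θ| ≤ 1 := by
    rcases Real.sign_apply_eq θ with h | h | h <;> simp [h]
  rw [multiplier, norm_mul, norm_mul, norm_mul, h1, norm_neg, Complex.norm_I, Complex.norm_real,
    Complex.norm_real, Real.norm_eq_abs, Real.norm_of_nonneg (Real.sqrt_nonneg _), one_mul, mul_one]
  exact mul_le_one₀ h2 (Real.sqrt_nonneg _) (sqrt_rho_le_one θ)

lemma measurable_multiplier : Measurable multiplier := by
  have h1 : Measurable Real.sign := by
    unfold Real.sign
    exact Measurable.ite measurableSet_Iio measurable_const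
      (Measurable.ite measurableSet_Ioi measurable_const measurable_const)
  have h2 : Measurable rho := by unfold rho; fun_prop
  unfold multiplier
  fun_prop

lemma memLp_multiplier : MemLp multiplier ∞ (volume.restrict (Set.Ioc (-Real.pi) Real.pi)) :=
  memLp_top_of_bound measurable_multiplier.aestronglyMeasurable 1
    (Eventually.of_forall norm_multiplier_le)

/-- `K_d(n)` as a sine coefficient at frequency `n + 1/2`, by pairing `θ` with `-θ`. -/
lemma kernelHd_eq (n : ℤ) : kernelHd n =
    ((1 / Real.pi *
      ∫ θ in (0 : ℝ)..Real.pi, sqrtRhoExt θ * Real.sin ((n + 1 / 2) * θ) : ℝ) : ℂ) := by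
  have hexp : Continuous fun θ : ℝ => Complex.exp (Complex.I * (n : ℂ) * (θ : ℂ)) := by fun_prop
  have hint : ∀ a b : ℝ, IntervalIntegrable
      (fun θ => multiplier θ * Complex.exp (Complex.I * (n : ℂ) * (θ : ℂ))) volume a b := by
    intro a b
    refine (intervalIntegrable_const (c := (1 : ℝ))).mono_fun
      (measurable_multiplier.mul hexp.measurable).aestronglyMeasurable
      (Eventually.of_forall fun θ => ?_)
    beta_reduce
    rw [norm_mul, norm_exp_I_intCast_mul, mul_one]
    simpa using norm_multiplier_le θ
  rw [kernelHd, invFourier,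
    ← intervalIntegral.integral_add_adjacent_intervals (hint _ 0) (hint 0 _)]
  have hneg := intervalIntegral.integral_comp_neg (a := 0) (b := Real.pi)
    (fun θ => multiplier θ * Complex.exp (Complex.I * (n : ℂ) * (θ : ℂ)))
  rw [neg_zero] at hneg
  rw [← hneg, ← intervalIntegral.integral_add _ (hint _ _)]
  · rw [Complex.ofReal_mul, ← intervalIntegral.integral_ofReal]
    have : ∀ θ ∈ Set.uIcc (0 : ℝ) Real.pi,
        (multiplier (-θ) * Complex.exp (Complex.I * (n : ℂ) * ((-θ : ℝ) : ℂ)) +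
          multiplier θ * Complex.exp (Complex.I * (n : ℂ) * (θ : ℂ))) =
        2 * ((sqrtRhoExt θ * Real.sin ((n + 1 / 2) * θ) : ℝ) : ℂ) := by
      intro θ hθ
      rw [Set.uIcc_of_le Real.pi_pos.le] at hθ
      rcases hθ.1.eq_or_lt with rfl | hpos
      · simp [multiplier]
      rw [multiplier, multiplier, rho_neg, sqrt_rho_eq hθ.1 hθ.2, Real.sign_of_pos hpos,
        Real.sign_of_neg (by linarith)]
      have e1 : Complex.exp (Complex.I * ((-θ : ℝ) : ℂ) / 2) *
          Complex.exp (Complex.I * (n : ℂ) * ((-θ : ℝ) : ℂ)) =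
          Complex.exp (-(((n + 1 / 2) * θ : ℝ) : ℂ) * Complex.I) := by
        rw [← Complex.exp_add]; congr 1; push_cast; ring
      have e2 : Complex.exp (Complex.I * (θ : ℂ) / 2) *
          Complex.exp (Complex.I * (n : ℂ) * (θ : ℂ)) =
          Complex.exp ((((n + 1 / 2) * θ : ℝ) : ℂ) * Complex.I) := by
        rw [← Complex.exp_add]; congr 1; push_cast; ring
      rw [mul_assoc, e1, mul_assoc _ _ (Complex.exp (Complex.I * (n : ℂ) * (θ : ℂ))), e2,
        Complex.ofReal_mul (sqrtRhoExt θ), Complex.ofReal_sin, Complex.sin]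
      push_cast
      ring
    rw [intervalIntegral.integral_congr this, intervalIntegral.integral_const_mul]
    have : (Real.pi : ℂ) ≠ 0 := by exact_mod_cast Real.pi_ne_zero
    push_cast
    field_simp
  · have := (IntervalIntegrable.iff_comp_neg
      (f := fun θ => multiplier θ * Complex.exp (Complex.I * (n : ℂ) * (θ : ℂ)))).1
      (hint 0 (-Real.pi))
    simpa using this

/-- `K_d` is odd about `-1/2`. -/
lemma kernelHd_neg (n : ℤ) : kernelHd (-n) = -kernelHd (n - 1) := by
  rw [kernelHd_eq, kernelHd_eq, ← Complex.ofReal_neg]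
  congr 1
  rw [← mul_neg, ← intervalIntegral.integral_neg]
  congr 1
  refine intervalIntegral.integral_congr fun θ _ => ?_
  rw [← mul_neg, ← Real.sin_neg]
  congr 2
  push_cast
  ring

lemma contDiff_sqrtRhoExt : ContDiff ℝ 2 sqrtRhoExt := by
  unfold sqrtRhoExt
  have h : ContDiff ℝ 2 fun θ : ℝ => Real.sin (θ / 2) := by fun_prop
  refine ContDiff.sub (ContDiff.sqrt (contDiff_const.add (h.pow 2)) fun θ => ?_) h
  positivity

/-- Two integrations by parts for the sine coefficients at frequencies with `cos (N π) = 0`. -/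
lemma exists_sine_coeff_bound {f : ℝ → ℝ} (hf : ContDiff ℝ 2 f) :
    ∃ C : ℝ, ∀ N : ℝ, N ≠ 0 → Real.cos (N * Real.pi) = 0 →
      |(∫ θ in (0 : ℝ)..Real.pi, f θ * Real.sin (N * θ)) - f 0 / N| ≤ C / N ^ 2 := by
  have hf1 : ContDiff ℝ 1 (deriv f) := by
    have : ContDiff ℝ (1 + 1) f := by simpa [one_add_one_eq_two] using hf
    exact (contDiff_succ_iff_deriv.1 this).2.2
  have hd : ∀ x, HasDerivAt f (deriv f x) x := fun x =>
    (hf.differentiable (by norm_num) x).hasDerivAt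
  have hd1 : ∀ x, HasDerivAt (deriv f) (deriv (deriv f) x) x := fun x =>
    (hf1.differentiable (by norm_num) x).hasDerivAt
  have hc1 : Continuous (deriv f) := hf1.continuous
  have hc2 : Continuous (deriv (deriv f)) := hf1.continuous_deriv le_rfl
  refine ⟨|deriv f Real.pi| + ∫ θ in (0 : ℝ)..Real.pi, |deriv (deriv f) θ|, fun N hN hcos => ?_⟩
  have i1 := intervalIntegral.integral_mul_deriv_eq_deriv_mul (a := 0) (b := Real.pi) (u := f)
    (v := fun θ => -(Real.cos (N * θ) / N)) (u' := deriv f) (v' := fun θ => Real.sin (N * θ))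
    (fun x _ => hd x) (fun x _ => by
      have h := (((hasDerivAt_id x).const_mul N).cos.div_const N).neg
      refine h.congr_deriv ?_
      simp only [id, mul_one]
      field_simp) (hc1.intervalIntegrable _ _)
    ((by fun_prop : Continuous fun θ => Real.sin (N * θ)).intervalIntegrable _ _)
  have i2 := intervalIntegral.integral_mul_deriv_eq_deriv_mul (a := 0) (b := Real.pi)
    (u := deriv f) (v := fun θ => -(Real.sin (N * θ) / N ^ 2)) (u' := deriv (deriv f))
    (v' := fun θ => -(Real.cos (N * θ) / N))
    (fun x _ => hd1 x) (fun x _ => by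
      have h := (((hasDerivAt_id x).const_mul N).sin.div_const (N ^ 2)).neg
      refine h.congr_deriv ?_
      simp only [id, mul_one]
      field_simp) (hc2.intervalIntegrable _ _)
    ((by fun_prop : Continuous fun θ => -(Real.cos (N * θ) / N)).intervalIntegrable _ _)
  rw [i2] at i1
  simp only [hcos, mul_zero, Real.cos_zero, Real.sin_zero, zero_div, neg_zero] at i1
  have hbound : |∫ θ in (0 : ℝ)..Real.pi, deriv (deriv f) θ * -(Real.sin (N * θ) / N ^ 2)| ≤
      (∫ θ in (0 : ℝ)..Real.pi, |deriv (deriv f) θ|) / N ^ 2 := by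
    refine (intervalIntegral.abs_integral_le_integral_abs Real.pi_pos.le).trans ?_
    rw [← intervalIntegral.integral_div]
    refine intervalIntegral.integral_mono_on Real.pi_pos.le ?_ ?_ fun θ _ => ?_
    · exact (by fun_prop : Continuous fun θ =>
        |deriv (deriv f) θ * -(Real.sin (N * θ) / N ^ 2)|).intervalIntegrable _ _
    · exact (by fun_prop : Continuous fun θ => |deriv (deriv f) θ| / N ^ 2).intervalIntegrable _ _
    · rw [abs_mul, abs_neg, abs_div, abs_of_nonneg (sq_nonneg N), ← mul_div_assoc]
      gcongr
      exact mul_le_of_le_one_right (abs_nonneg _) (Real.abs_sin_le_one _)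
  have hbd : |deriv f Real.pi * -(Real.sin (N * Real.pi) / N ^ 2)| ≤ |deriv f Real.pi| / N ^ 2 := by
    rw [abs_mul, abs_neg, abs_div, abs_of_nonneg (sq_nonneg N), ← mul_div_assoc]
    gcongr
    exact mul_le_of_le_one_right (abs_nonneg _) (Real.abs_sin_le_one _)
  rw [add_div]
  have e : (∫ θ in (0 : ℝ)..Real.pi, f θ * Real.sin (N * θ)) - f 0 / N =
      -(deriv f Real.pi * -(Real.sin (N * Real.pi) / N ^ 2)) +
      ∫ θ in (0 : ℝ)..Real.pi, deriv (deriv f) θ * -(Real.sin (N * θ) / N ^ 2) := by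
    rw [i1]; ring
  rw [e]
  refine (abs_add_le _ _).trans ?_
  rw [abs_neg]
  exact add_le_add hbd hbound

lemma cos_half_add_mul_pi (n : ℤ) : Real.cos (((n : ℝ) + 1 / 2) * Real.pi) = 0 := by
  rw [Real.cos_eq_zero_iff]
  exact ⟨n, by ring⟩

/-- The main term of the sine coefficients of `ρ^{1/2}` is exactly the Riesz–Titchmarsh kernel. -/
lemma exists_kernelD_bound : ∃ C : ℝ, ∀ n : ℤ, ‖kernelD n‖ ≤ C / |(n : ℝ) + 1 / 2| ^ 2 := by
  obtain ⟨C, hC⟩ := exists_sine_coeff_bound contDiff_sqrtRhoExt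
  refine ⟨C / Real.pi, fun n => ?_⟩
  have h := hC _ (half_add_ne n) (cos_half_add_mul_pi n)
  have h0 : sqrtRhoExt 0 = 1 := by simp [sqrtRhoExt]
  have e : kernelD n = ((1 / Real.pi * ((∫ θ in (0 : ℝ)..Real.pi,
      sqrtRhoExt θ * Real.sin (((n : ℝ) + 1 / 2) * θ)) - sqrtRhoExt 0 / ((n : ℝ) + 1 / 2)) : ℝ) :
        ℂ) := by
    rw [kernelD, kernelHd_eq, kernelHplus, h0, mul_sub, Complex.ofReal_sub]
    congr 1
    push_cast
    rw [div_mul_div_comm, one_mul]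
  rw [e, Complex.norm_real, Real.norm_eq_abs, abs_mul, abs_of_pos (by positivity), sq_abs]
  calc 1 / Real.pi * _ ≤ 1 / Real.pi * (C / ((n : ℝ) + 1 / 2) ^ 2) := by gcongr
    _ = _ := by ring

lemma memSeq_kernelD : MemSeq 1 kernelD := by
  obtain ⟨C, hC⟩ := exists_kernelD_bound
  rw [memSeq_one_iff]
  refine Summable.of_norm_bounded
    ((summable_half_rpow (q := 2) (by norm_num)).mul_left C) fun n => ?_
  rw [Real.rpow_neg (abs_nonneg _), ← div_eq_mul_inv]
  exact_mod_cast hC n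

lemma kernelHd_eq_add : kernelHd = fun n => kernelHplus n + kernelD n := by
  funext n; simp [kernelD]

lemma memSeq_kernelHd {q : ℝ≥0∞} (hq : 1 < q) : MemSeq q kernelHd := by
  rw [kernelHd_eq_add]
  exact (memSeq_kernelHplus hq).add (memSeq_kernelD.mono (by norm_num) hq.le)

/-- Hölder's inequality: only `p = ∞`, where the conjugate exponent is `1`, is excluded. -/
lemma summable_conv_of_forall_memSeq {K : ℤ → ℂ} (hK : ∀ q : ℝ≥0∞, 1 < q → MemSeq q K) {p : ℝ≥0∞}
    (h1 : 1 ≤ p) (ht : p < ∞) {a : ℤ → ℂ} (ha : MemSeq p a) (n : ℤ) :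
    Summable (fun m => K (n - m) * a m) := by
  have := ENNReal.HolderConjugate.conjExponent h1
  have hq : 1 < ENNReal.conjExponent p :=
    (ENNReal.HolderConjugate.lt_top_iff_one_lt p (ENNReal.conjExponent p)).1 ht
  have := ENNReal.HolderConjugate.symm (p := p) (q := ENNReal.conjExponent p)
  exact summable_conv (hK _ hq) ha n

/-! ### Interpolation and duality -/

/-- The two integrals over the height `t` in Marcinkiewicz interpolation, for a single entry of
modulus `x`; they converge at `0` and `∞` because `1 < r < 2`. -/
lemma lintegral_layer_le {r : ℝ} (h1 : 1 < r) (h2 : r < 2) {A B x : ℝ} (hA : 0 ≤ A) (hB : 0 ≤ B)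
    (hx : 0 ≤ x) :
    ∫⁻ t in Set.Ioi (0 : ℝ),
        ENNReal.ofReal (if t < x then A * x * t ^ (r - 2) else B * x ^ 2 * t ^ (r - 3)) ≤
      ENNReal.ofReal ((A / (r - 1) + B / (2 - r)) * x ^ r) := by
  rcases hx.eq_or_lt with rfl | hx
  · refine le_of_eq_of_le ?_ zero_le
    rw [setLIntegral_congr_fun (g := fun _ => 0) measurableSet_Ioi]
    · simp
    · intro t _
      simp
  have hsplit : Set.Ioi (0 : ℝ) = Set.Ioc 0 x ∪ Set.Ioi x := (Set.Ioc_union_Ioi_eq_Ioi hx.le).symm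
  have e1 : ∫⁻ t in Set.Ioc (0 : ℝ) x,
      ENNReal.ofReal (if t < x then A * x * t ^ (r - 2) else B * x ^ 2 * t ^ (r - 3)) =
      ENNReal.ofReal (A / (r - 1) * x ^ r) := by
    rw [← restrict_Ioo_eq_restrict_Ioc,
      setLIntegral_congr_fun (g := fun t => ENNReal.ofReal (A * x * t ^ (r - 2))) measurableSet_Ioo
        (fun t ht => by simp only [if_pos ht.2]), restrict_Ioo_eq_restrict_Ioc]
    have hi : IntervalIntegrable (fun t : ℝ => t ^ (r - 2)) volume 0 x :=
      intervalIntegral.intervalIntegrable_rpow' (by linarith)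
    rw [← ofReal_integral_eq_lintegral_ofReal]
    · rw [integral_const_mul, ← intervalIntegral.integral_of_le hx.le,
        integral_rpow (Or.inl (by linarith)), Real.zero_rpow (by linarith), sub_zero,
        show r - 2 + 1 = r - 1 by ring]
      congr 1
      have : x ^ r = x * x ^ (r - 1) := by
        rw [← Real.rpow_one_add' hx.le (by linarith)]; congr 1; ring
      rw [this]
      ring
    · exact ((intervalIntegrable_iff_integrableOn_Ioc_of_le hx.le).1 hi).const_mul _
    · filter_upwards [self_mem_ae_restrict measurableSet_Ioc] with t ht
      have := ht.1
      positivity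
  have e2 : ∫⁻ t in Set.Ioi x,
      ENNReal.ofReal (if t < x then A * x * t ^ (r - 2) else B * x ^ 2 * t ^ (r - 3)) =
      ENNReal.ofReal (B / (2 - r) * x ^ r) := by
    rw [setLIntegral_congr_fun (g := fun t => ENNReal.ofReal (B * x ^ 2 * t ^ (r - 3)))
      measurableSet_Ioi
      (fun t ht => by simp only [if_neg (not_lt.2 (le_of_lt (Set.mem_Ioi.1 ht)))])]
    rw [← ofReal_integral_eq_lintegral_ofReal]
    · rw [integral_const_mul, integral_Ioi_rpow_of_lt (by linarith) hx,
        show r - 3 + 1 = r - 2 by ring]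
      congr 1
      have : x ^ r = x ^ 2 * x ^ (r - 2) := by
        rw [← Real.rpow_natCast x 2, ← Real.rpow_add hx]; congr 1; push_cast; ring
      have h3 : r - 2 ≠ 0 := by linarith
      have h4 : 2 - r ≠ 0 := by linarith
      rw [this]
      rw [show r - 2 = -(2 - r) by ring, div_neg, neg_div, neg_neg]
      ring
    · exact (integrableOn_Ioi_rpow_of_lt (by linarith) hx).const_mul _
    · filter_upwards [self_mem_ae_restrict measurableSet_Ioi] with t ht
      have : 0 < t := hx.trans ht
      positivity
  rw [hsplit]
  refine (lintegral_union_le _ _ _).trans (le_of_eq ?_)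
  rw [e1, e2, ← ENNReal.ofReal_add, add_mul]
  · have : 0 < r - 1 := by linarith
    positivity
  · have : 0 < 2 - r := by linarith
    positivity

/-- Marcinkiewicz interpolation between weak type `(1,1)` and the `ℓ²` contraction property:
at height `t` the sequence is cut into its parts above and below `t`. -/
lemma boundedOn_of_weakType {K : ℤ → ℂ} (hK : ∀ q : ℝ≥0∞, 1 < q → MemSeq q K) {C : ℝ≥0}
    (hw : WeakType11With C (conv K))
    (h2 : ∀ a, MemSeq 2 a → seqNorm 2 (conv K a) ≤ seqNorm 2 a) {p : ℝ≥0∞} (hp1 : 1 < p)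
    (hp2 : p < 2) : BoundedOn p (conv K) := by
  have hpt : p ≠ ∞ := (hp2.trans (by norm_num)).ne
  have hp0 : p ≠ 0 := (zero_lt_one.trans hp1).ne'
  have hr1 : 1 < p.toReal := by
    simpa using (ENNReal.toReal_lt_toReal ENNReal.one_ne_top hpt).2 hp1
  have hr2 : p.toReal < 2 := by
    simpa using (ENNReal.toReal_lt_toReal hpt (by norm_num : (2 : ℝ≥0∞) ≠ ∞)).2 hp2
  set r := p.toReal with hr
  have hr0 : 0 < r := by linarith
  set A : ℝ≥0∞ := ENNReal.ofReal r * ENNReal.ofReal (2 * C / (r - 1) + 4 / (2 - r)) with hA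
  have hc0 : 0 ≤ 2 * C / (r - 1) + 4 / (2 - r) := by
    have h3 : 0 < r - 1 := by linarith
    have h4 : 0 < 2 - r := by linarith
    positivity
  have hAt : A ^ (1 / r) ≠ ∞ := ENNReal.rpow_ne_top_of_nonneg (by positivity)
    (ENNReal.mul_ne_top ENNReal.ofReal_ne_top ENNReal.ofReal_ne_top)
  have main : ∀ a, MemSeq p a → seqNorm p (conv K a) ≤ A ^ (1 / r) * seqNorm p a := by
    intro a ha
    have ha2 : MemSeq 2 a := ha.mono hp0 hp2.le
    have hlevel : ∀ t : ℝ, 0 < t → distrib (conv K a) t * ENNReal.ofReal (t ^ (r - 1)) ≤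
        ∑' n, ENNReal.ofReal (if t < ‖a n‖ then 2 * C * ‖a n‖ * t ^ (r - 2) else
          4 * ‖a n‖ ^ 2 * t ^ (r - 3)) := by
      intro t ht
      let b : ℤ → ℂ := fun n => if t < ‖a n‖ then a n else 0
      let c : ℤ → ℂ := fun n => if t < ‖a n‖ then 0 else a n
      have hbc : a = fun n => b n + c n := by
        funext n; simp only [b, c]; split_ifs <;> simp
      have hfin : {n : ℤ | t < ‖a n‖}.Finite := by
        have h5 : distrib a t < ∞ := (distrib_le_rpow hp0 hpt a ht).trans_lt
          (ENNReal.rpow_lt_top_of_nonneg hr0.le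
            (ENNReal.div_ne_top ha.2.ne (by simpa using ht)))
        rw [distrib_eq_count] at h5
        exact Measure.count_apply_lt_top.1 h5
      have hb1 : MemSeq 1 b := by
        rw [memSeq_one_iff]
        refine summable_of_ne_finset_zero (s := hfin.toFinset) fun n hn => ?_
        have : ¬ t < ‖a n‖ := by simpa using hn
        exact if_neg this
      have hc2 : MemSeq 2 c := ha2.of_le AEStronglyMeasurable.of_discrete
        (Eventually.of_forall fun n => by simp only [c]; split_ifs <;> simp)
      have hsplit : conv K a = fun n => conv K b n + conv K c n := by
        funext n
        conv_lhs => rw [hbc]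
        exact conv_add
          (summable_conv_of_forall_memSeq hK le_rfl ENNReal.one_lt_top hb1 n)
          (summable_conv_of_forall_memSeq hK one_le_two (by norm_num) hc2 n)
      have ht2 : 0 < t / 2 := by positivity
      have hd : distrib (conv K a) t ≤ C * seqNorm 1 b / ENNReal.ofReal (t / 2) +
          seqNorm 2 c ^ (2 : ℝ) / ENNReal.ofReal (t / 2) ^ (2 : ℝ) := by
        rw [hsplit]
        refine (distrib_add_le _ _ _).trans (add_le_add (hw b hb1 _ ht2) ?_)
        refine (distrib_le_rpow (p := 2) (by norm_num) (by norm_num) _ ht2).trans ?_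
        rw [ENNReal.toReal_ofNat, ← ENNReal.div_rpow_of_nonneg _ _ (by norm_num)]
        gcongr
        exact h2 c hc2
      refine (mul_le_mul_left hd _).trans (le_of_eq ?_)
      have h6 := seqNorm_rpow (p := 2) (by norm_num) (by norm_num) c
      rw [ENNReal.toReal_ofNat] at h6
      rw [seqNorm_one, h6, mul_div_assoc, ENNReal.div_eq_inv_mul, ENNReal.div_eq_inv_mul,
        ← ENNReal.tsum_mul_left, ← ENNReal.tsum_mul_left, ← ENNReal.tsum_mul_left,
        ← ENNReal.tsum_add, ← ENNReal.tsum_mul_right]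
      refine tsum_congr fun n => ?_
      have hCC : (C : ℝ≥0∞) = ENNReal.ofReal (C : ℝ) := by simp
      simp only [b, c]
      split_ifs with hn
      · rw [enorm_zero, ENNReal.zero_rpow_of_pos (by norm_num), mul_zero, add_zero, hCC,
          ← ofReal_norm, ← ENNReal.ofReal_inv_of_pos ht2, ← ENNReal.ofReal_mul (by positivity),
          ← ENNReal.ofReal_mul (by positivity), ← ENNReal.ofReal_mul (by positivity)]
        congr 1
        rw [show r - 1 = r - 2 + 1 by ring, Real.rpow_add_one ht.ne']
        field_simp
      · rw [enorm_zero, mul_zero, mul_zero, zero_add, ← ofReal_norm,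
          ENNReal.ofReal_rpow_of_nonneg (norm_nonneg _) (by norm_num),
          ENNReal.ofReal_rpow_of_pos ht2, ← ENNReal.ofReal_inv_of_pos (by positivity),
          ← ENNReal.ofReal_mul (by positivity), ← ENNReal.ofReal_mul (by positivity)]
        congr 1
        rw [show r - 1 = r - 3 + 1 + 1 by ring, Real.rpow_add_one ht.ne', Real.rpow_add_one ht.ne',
          Real.rpow_two, Real.rpow_two]
        field_simp
        ring
    have hlayer := lintegral_rpow_eq_lintegral_meas_lt_mul (Measure.count : Measure ℤ)
      (f := fun n => ‖conv K a n‖) (Eventually.of_forall fun _ => norm_nonneg _)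
      (measurable_of_countable _).aemeasurable hr0
    have hsum : ∑' n, ‖conv K a n‖ₑ ^ r ≤ A * ∑' n, ‖a n‖ₑ ^ r := by
      calc ∑' n, ‖conv K a n‖ₑ ^ r = ∫⁻ n, ENNReal.ofReal (‖conv K a n‖ ^ r) ∂Measure.count := by
            rw [lintegral_count]
            refine tsum_congr fun n => ?_
            rw [← ofReal_norm, ENNReal.ofReal_rpow_of_nonneg (norm_nonneg _) hr0.le]
        _ = ENNReal.ofReal r * ∫⁻ t in Set.Ioi (0 : ℝ),
              distrib (conv K a) t * ENNReal.ofReal (t ^ (r - 1)) := by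
            rw [hlayer]
            simp_rw [distrib_eq_count]
        _ ≤ ENNReal.ofReal r * ∫⁻ t in Set.Ioi (0 : ℝ),
              ∑' n, ENNReal.ofReal (if t < ‖a n‖ then 2 * C * ‖a n‖ * t ^ (r - 2) else
                4 * ‖a n‖ ^ 2 * t ^ (r - 3)) := by
            gcongr 1
            exact setLIntegral_mono' measurableSet_Ioi fun t ht => hlevel t ht
        _ = ENNReal.ofReal r * ∑' n, ∫⁻ t in Set.Ioi (0 : ℝ),
              ENNReal.ofReal (if t < ‖a n‖ then 2 * C * ‖a n‖ * t ^ (r - 2) else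
                4 * ‖a n‖ ^ 2 * t ^ (r - 3)) := by
            rw [lintegral_tsum]
            intro n
            refine Measurable.aemeasurable (Measurable.ennreal_ofReal ?_)
            exact Measurable.ite measurableSet_Iio (by fun_prop) (by fun_prop)
        _ ≤ ENNReal.ofReal r * ∑' n,
              ENNReal.ofReal ((2 * C / (r - 1) + 4 / (2 - r)) * ‖a n‖ ^ r) := by
            gcongr with n
            exact lintegral_layer_le hr1 hr2 (by positivity) (by norm_num) (norm_nonneg _)
        _ = _ := by
            rw [hA, mul_assoc]
            congr 1
            rw [← ENNReal.tsum_mul_left]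
            refine tsum_congr fun n => ?_
            rw [ENNReal.ofReal_mul hc0, ← ofReal_norm,
              ENNReal.ofReal_rpow_of_nonneg (norm_nonneg _) hr0.le]
    rw [seqNorm_eq hp0 hpt, seqNorm_eq hp0 hpt, ← ENNReal.mul_rpow_of_nonneg _ _ (by positivity)]
    gcongr
  refine ⟨(A ^ (1 / r)).toNNReal, fun a ha => ?_⟩
  rw [ENNReal.coe_toNNReal hAt]
  exact ⟨memSeq_iff.2 ((main a ha).trans_lt (ENNReal.mul_lt_top hAt.lt_top ha.2)), main a ha⟩

/-- Duality. A kernel that is odd about `-1/2` is, up to sign and a shift, its own transpose, so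
boundedness on `ℓ^q` passes to the conjugate exponent. -/
lemma BoundedOn.dual {K : ℤ → ℂ} (hK : ∀ q : ℝ≥0∞, 1 < q → MemSeq q K)
    (hodd : ∀ n, K (-n) = -K (n - 1)) {p q : ℝ≥0∞} [hpq : p.HolderConjugate q] (hp : 1 < p)
    (hpt : p < ∞) (hq : BoundedOn q (conv K)) : BoundedOn p (conv K) := by
  obtain ⟨C, hC⟩ := hq
  have hq1 : 1 < q := (ENNReal.HolderConjugate.lt_top_iff_one_lt p q).1 hpt
  have hqp : q.HolderConjugate p := ENNReal.HolderConjugate.symm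
  have hqt : q < ∞ := (ENNReal.HolderConjugate.lt_top_iff_one_lt q p).2 hp
  have hp0 : p ≠ 0 := (zero_lt_one.trans hp).ne'
  have hq0 : q ≠ 0 := (zero_lt_one.trans hq1).ne'
  have hconj : p.toReal.HolderConjugate q.toReal :=
    ENNReal.HolderConjugate.toReal_of_ne_top hpt.ne hqt.ne
  set r := p.toReal with hr
  set s := q.toReal with hs
  have hr0 : 0 < r := hconj.pos
  have hs0 : 0 < s := hconj.symm.pos
  have hr1 : 1 < r := hconj.lt
  have main : ∀ a, MemSeq p a → seqNorm p (conv K a) ≤ C * seqNorm p a := by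
    intro a ha
    set F := conv K a with hF
    have hfin : ∀ S : Finset ℤ, ∑ n ∈ S, ‖F n‖ₑ ^ r ≤ (C * seqNorm p a) ^ r := by
      intro S
      classical
      set X := ∑ n ∈ S, ‖F n‖ₑ ^ r with hX
      have hXt : X ≠ ∞ := by
        refine (ENNReal.sum_lt_top.2 fun n _ => ?_).ne
        exact ENNReal.rpow_lt_top_of_nonneg hr0.le enorm_ne_top
      -- the extremizer in Hölder's inequality, cut off to the finite set
      let b : ℤ → ℂ := fun n => if n ∈ S then conj (F n) * ((‖F n‖ ^ (r - 2) : ℝ) : ℂ) else 0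
      have hb0 : ∀ n ∉ S, b n = 0 := fun n hn => if_neg hn
      have hbS : ∀ n ∈ S, b n = conj (F n) * ((‖F n‖ ^ (r - 2) : ℝ) : ℂ) := fun n hn => if_pos hn
      have hFb : ∀ n ∈ S, F n * b n = ((‖F n‖ ^ r : ℝ) : ℂ) := by
        intro n hn
        rw [hbS n hn, ← mul_assoc, Complex.mul_conj, ← Complex.ofReal_mul,
          Complex.normSq_eq_norm_sq]
        congr 1
        rcases (norm_nonneg (F n)).eq_or_lt with h | h
        · rw [← h, Real.zero_rpow hr0.ne']; simp
        · rw [← Real.rpow_natCast, ← Real.rpow_add h]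
          congr 1; push_cast; ring
      have hbn : ∀ n ∈ S, ‖b n‖ₑ ^ s = ‖F n‖ₑ ^ r := by
        intro n hn
        have h1 : ‖b n‖ = ‖F n‖ ^ (r - 1) := by
          rw [hbS n hn, norm_mul, RCLike.norm_conj, Complex.norm_real,
            Real.norm_of_nonneg (by positivity)]
          rcases (norm_nonneg (F n)).eq_or_lt with h | h
          · rw [← h, Real.zero_rpow (by linarith : r - 1 ≠ 0)]; simp
          · rw [← Real.rpow_one_add' h.le (by linarith)]
            congr 1; ring
        rw [← ofReal_norm, h1, ← ENNReal.ofReal_rpow_of_nonneg (norm_nonneg _) (by linarith),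
          ← ENNReal.rpow_mul, hconj.sub_one_mul_conj, ofReal_norm]
      have hbnorm : seqNorm q b = X ^ (1 / s) := by
        rw [seqNorm_eq hq0 hqt.ne, tsum_eq_sum (s := S)]
        · rw [Finset.sum_congr rfl hbn]
        · intro n hn
          rw [hb0 n hn, enorm_zero, ENNReal.zero_rpow_of_pos hs0]
      have hbm : MemSeq q b := by
        rw [memSeq_iff, hbnorm]
        exact ENNReal.rpow_lt_top_of_nonneg (by positivity) hXt
      have hpair : ∑ n ∈ S, F n * b n = ∑' m, a m * -conv K b (m - 1) := by
        have hsm : ∀ n ∈ S, Summable fun m => K (n - m) * a m * b n := fun n _ =>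
          (summable_conv_of_forall_memSeq hK hp.le hpt ha n).mul_right _
        calc ∑ n ∈ S, F n * b n = ∑ n ∈ S, ∑' m, K (n - m) * a m * b n := by
              refine Finset.sum_congr rfl fun n _ => ?_
              rw [hF, conv, ← tsum_mul_right]
          _ = ∑' m, ∑ n ∈ S, K (n - m) * a m * b n := (Summable.tsum_finsetSum hsm).symm
          _ = _ := by
              refine tsum_congr fun m => ?_
              rw [conv, tsum_eq_sum (s := S) (fun n hn => by rw [hb0 n hn, mul_zero]),
                ← Finset.sum_neg_distrib, Finset.mul_sum]
              refine Finset.sum_congr rfl fun n _ => ?_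
              rw [← neg_sub m n, hodd, show m - n - 1 = m - 1 - n by ring]
              ring
      have hholder : X ≤ seqNorm p a * seqNorm q (conv K b) := by
        have h1 : X = ‖∑ n ∈ S, F n * b n‖ₑ := by
          rw [Finset.sum_congr rfl hFb, ← Complex.ofReal_sum, ← ofReal_norm, Complex.norm_real,
            Real.norm_of_nonneg (Finset.sum_nonneg fun _ _ => by positivity),
            ENNReal.ofReal_sum_of_nonneg (fun _ _ => by positivity), hX]
          refine Finset.sum_congr rfl fun n _ => ?_
          rw [← ofReal_norm, ENNReal.ofReal_rpow_of_nonneg (norm_nonneg _) hr0.le]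
        rw [h1, hpair]
        refine enorm_tsum_le_tsum_enorm.trans ?_
        have h2 := eLpNorm_smul_le_mul_eLpNorm (p := p) (q := q) (r := 1) (μ := Measure.count)
          (f := fun m => -conv K b (m - 1)) (φ := a)
          AEStronglyMeasurable.of_discrete AEStronglyMeasurable.of_discrete
        have h3 : seqNorm q (fun m => -conv K b (m - 1)) = seqNorm q (conv K b) := by
          rw [← seqNorm_comp_equiv q (conv K b) (Equiv.subRight 1)]
          exact eLpNorm_neg (f := fun m => conv K b (m - 1)) (p := q) (μ := Measure.count)
        rw [← seqNorm_one (fun m => a m * -conv K b (m - 1)), ← h3]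
        exact h2
      have hX2 : X ≤ C * seqNorm p a * X ^ (1 / s) := by
        refine hholder.trans ?_
        rw [← hbnorm, mul_comm (C : ℝ≥0∞), mul_assoc]
        gcongr
        exact (hC b hbm).2
      rcases eq_or_ne X 0 with h0 | h0
      · rw [h0]; exact zero_le
      have h4 : X = X ^ (1 / r) * X ^ (1 / s) := by
        rw [← ENNReal.rpow_add _ _ h0 hXt]
        have := hconj.inv_add_inv_eq_one
        rw [one_div, one_div, this, ENNReal.rpow_one]
      have h5 : X ^ (1 / r) ≤ C * seqNorm p a := by
        have h6 : X ^ (1 / s) ≠ 0 := by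
          simp [ENNReal.rpow_eq_zero_iff, h0, hXt]
        have h7 : X ^ (1 / s) ≠ ∞ := ENNReal.rpow_ne_top_of_nonneg (by positivity) hXt
        rw [← ENNReal.mul_le_mul_iff_left h6 h7, ← h4]
        exact hX2
      calc X = (X ^ (1 / r)) ^ r := by
            rw [← ENNReal.rpow_mul, one_div_mul_cancel hr0.ne', ENNReal.rpow_one]
        _ ≤ _ := by gcongr
    rw [seqNorm_eq hp0 hpt.ne]
    calc (∑' n, ‖F n‖ₑ ^ r) ^ (1 / r) ≤ ((C * seqNorm p a) ^ r) ^ (1 / r) := by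
          gcongr
          rw [ENNReal.tsum_eq_iSup_sum]
          exact iSup_le hfin
      _ = _ := by rw [← ENNReal.rpow_mul, mul_one_div_cancel hr0.ne', ENNReal.rpow_one]
  exact ⟨C, fun a ha =>
    ⟨memSeq_iff.2 ((main a ha).trans_lt (ENNReal.mul_lt_top ENNReal.coe_lt_top ha.2)), main a ha⟩⟩

/-! ### The discrete Hilbert transform -/

lemma Hd_eq_add {p : ℝ≥0∞} (hp : 1 ≤ p) (hpt : p < ∞) {a : ℤ → ℂ} (ha : MemSeq p a) (n : ℤ) :
    Hd a n = Hplus a n + conv kernelD a n := by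
  have h1 := summable_conv_of_forall_memSeq (fun q hq => memSeq_kernelHplus hq) hp hpt ha n
  have h2 := summable_conv_of_forall_memSeq
    (fun q hq => memSeq_kernelD.mono one_ne_zero (le_of_lt hq)) hp hpt ha n
  rw [Hd, Hplus, conv, conv, conv, ← h1.tsum_add h2, kernelHd_eq_add]
  exact tsum_congr fun m => add_mul _ _ _

/-- Halving the height doubles the constants `64` of `H⁺` and `‖D‖₁` of `D *`; the excess `‖D‖₁` is
absorbed into the constant of the first summand, as `‖D‖₁` is finite. -/
lemma distrib_Hd_le {a : ℤ → ℂ} (ha : MemSeq 1 a) {t : ℝ} (ht : 0 < t) :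
    distrib (Hd a) t ≤ ((128 + (seqNorm 1 kernelD).toNNReal : ℝ≥0) : ℝ≥0∞) * seqNorm 1 a /
        ENNReal.ofReal t + seqNorm 1 kernelD * seqNorm 1 a / ENNReal.ofReal t := by
  have h0 : Hd a = fun n => Hplus a n + conv kernelD a n :=
    funext fun n => Hd_eq_add le_rfl ENNReal.one_lt_top ha n
  have ht2 : 0 < t / 2 := by positivity
  have hD : seqNorm 1 kernelD ≠ ∞ := memSeq_kernelD.2.ne
  have h1 := weakType_Hplus a ha _ ht2
  have h2 : distrib (conv kernelD a) (t / 2) ≤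
      seqNorm 1 kernelD * seqNorm 1 a / ENNReal.ofReal (t / 2) := by
    refine (distrib_le_rpow one_ne_zero ENNReal.one_ne_top _ ht2).trans ?_
    rw [ENNReal.toReal_one, ENNReal.rpow_one]
    gcongr
    exact seqNorm_conv_le le_rfl memSeq_kernelD ha
  have h3 : ∀ x : ℝ≥0∞, x / ENNReal.ofReal (t / 2) = 2 * x / ENNReal.ofReal t := by
    intro x
    rw [ENNReal.ofReal_div_of_pos two_pos, ENNReal.ofReal_ofNat, div_eq_mul_inv,
      ENNReal.inv_div (by simp) (by simp), ← mul_div_assoc, mul_comm x]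
  rw [h3] at h1 h2
  rw [h0]
  refine ((distrib_add_le _ _ _).trans (add_le_add h1 h2)).trans (le_of_eq ?_)
  rw [ENNReal.coe_add, ENNReal.coe_toNNReal hD]
  simp only [div_eq_mul_inv]
  push_cast
  ring

lemma WeakType11With.mono {C C' : ℝ≥0} {T : (ℤ → ℂ) → ℤ → ℂ} (h : WeakType11With C T)
    (hC : C ≤ C') : WeakType11With C' T := fun a ha t ht =>
  (h a ha t ht).trans (by gcongr)

lemma weakType_Hd : WeakType11With
    (128 + (seqNorm 1 kernelD).toNNReal + (seqNorm 1 kernelD).toNNReal) Hd := by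
  intro a ha t ht
  have hD : seqNorm 1 kernelD ≠ ∞ := memSeq_kernelD.2.ne
  refine (distrib_Hd_le ha ht).trans (le_of_eq ?_)
  push_cast
  rw [ENNReal.coe_toNNReal hD]
  simp only [add_mul, ENNReal.add_div]

lemma seqNorm_two_Hd_le {a : ℤ → ℂ} (ha : MemSeq 2 a) : seqNorm 2 (Hd a) ≤ seqNorm 2 a :=
  seqNorm_two_conv_invFourier_le measurable_multiplier.aestronglyMeasurable norm_multiplier_le ha

lemma boundedOn_Hd {p : ℝ≥0∞} (hp : 1 < p) (hpt : p < ∞) : BoundedOn p Hd := by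
  have small : ∀ {q : ℝ≥0∞}, 1 < q → q < 2 → BoundedOn q Hd := fun h1 h2 =>
    boundedOn_of_weakType (fun q hq => memSeq_kernelHd hq) weakType_Hd
      (fun a ha => seqNorm_two_Hd_le ha) h1 h2
  rcases lt_trichotomy p 2 with h | rfl | h
  · exact small hp h
  · exact ⟨1, fun a ha => ⟨memSeq_iff.2 ((seqNorm_two_Hd_le ha).trans_lt ha.2), by
      simpa using seqNorm_two_Hd_le ha⟩⟩
  · have hconj := ENNReal.HolderConjugate.conjExponent hp.le
    have hq1 : 1 < ENNReal.conjExponent p :=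
      (ENNReal.HolderConjugate.lt_top_iff_one_lt p (ENNReal.conjExponent p)).1 hpt
    have hq2 : ENNReal.conjExponent p < 2 := by
      rw [ENNReal.conjExponent, ← one_add_one_eq_two]
      have : 1 < p - 1 := by
        rw [lt_tsub_iff_right, one_add_one_eq_two]; exact h
      exact ENNReal.add_lt_add_left ENNReal.one_ne_top (ENNReal.inv_lt_one.2 this)
    exact (small hq1 hq2).dual (fun q hq => memSeq_kernelHd hq) kernelHd_neg hp hpt

end DiscreteHilbert

theorem proposition4p3 :
    -- on `ℓ¹`, `H_d` is the operator with the given Fourier multiplier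
    (∀ a : ℤ → ℂ, DiscreteHilbert.MemSeq 1 a → ∀ n : ℤ,
      DiscreteHilbert.Hd a n =
        DiscreteHilbert.invFourier
          (fun θ => DiscreteHilbert.multiplier θ * DiscreteHilbert.fourierSeq a θ) n) ∧
    -- the same on `ℓ²`, with `g` the `L²` Fourier transform of `a`
    (∀ (a : ℤ → ℂ) (g : ℝ → ℂ),
      MemLp g 2 (volume.restrict (Set.Ioc (-Real.pi) Real.pi)) →
      (∀ n : ℤ, DiscreteHilbert.invFourier g n = a n) → ∀ n : ℤ,
      DiscreteHilbert.Hd a n =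
        DiscreteHilbert.invFourier (fun θ => DiscreteHilbert.multiplier θ * g θ) n) ∧
    -- `D ∈ ℓ¹`
    DiscreteHilbert.MemSeq 1 DiscreteHilbert.kernelD ∧
    -- on `ℓ^p`, `1 ≤ p < ∞`, the defining series converge absolutely and `H_d = H⁺ + D*`
    (∀ p : ℝ≥0∞, 1 ≤ p → p < ∞ → ∀ a : ℤ → ℂ, DiscreteHilbert.MemSeq p a → ∀ n : ℤ,
      Summable (fun m : ℤ => DiscreteHilbert.kernelHd (n - m) * a m) ∧
      Summable (fun m : ℤ => DiscreteHilbert.kernelHplus (n - m) * a m) ∧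
      Summable (fun m : ℤ => DiscreteHilbert.kernelD (n - m) * a m) ∧
      DiscreteHilbert.Hd a n =
        DiscreteHilbert.Hplus a n + DiscreteHilbert.conv DiscreteHilbert.kernelD a n) ∧
    -- comparison of `ℓ^p` norms
    (∀ p : ℝ≥0∞, 1 < p → p < ∞ → ∀ a : ℤ → ℂ, DiscreteHilbert.MemSeq p a →
      DiscreteHilbert.seqNorm p (DiscreteHilbert.Hd a) ≤
        DiscreteHilbert.seqNorm p (DiscreteHilbert.Hplus a) +
          DiscreteHilbert.seqNorm 1 DiscreteHilbert.kernelD * DiscreteHilbert.seqNorm p a) ∧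
    -- the weak-type inequality, with `C` a weak-type constant of `H⁺`
    (∃ C : ℝ≥0, DiscreteHilbert.WeakType11With C DiscreteHilbert.Hplus ∧
      ∀ a : ℤ → ℂ, DiscreteHilbert.MemSeq 1 a → ∀ t : ℝ, 0 < t →
        DiscreteHilbert.distrib (DiscreteHilbert.Hd a) t ≤
          (C : ℝ≥0∞) * DiscreteHilbert.seqNorm 1 a / ENNReal.ofReal t +
            DiscreteHilbert.seqNorm 1 DiscreteHilbert.kernelD * DiscreteHilbert.seqNorm 1 a /
              ENNReal.ofReal t) ∧
    -- consequences
    (∃ C : ℝ≥0, DiscreteHilbert.WeakType11With C DiscreteHilbert.Hd) ∧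
    (∀ p : ℝ≥0∞, 1 < p → p < ∞ → DiscreteHilbert.BoundedOn p DiscreteHilbert.Hd) := by
  open DiscreteHilbert in
  refine ⟨fun a ha n => ?_, fun a g hg hga n => ?_, memSeq_kernelD, fun p hp hpt a ha n => ?_,
    fun p hp hpt a ha => ?_, ?_, ⟨_, weakType_Hd⟩, fun p hp hpt => boundedOn_Hd hp hpt⟩
  · exact conv_invFourier_of_summable memLp_multiplier (memSeq_one_iff.1 ha) n
  · rw [← conv_invFourier memLp_multiplier hg n, funext hga]
    rfl
  · exact ⟨summable_conv_of_forall_memSeq (fun q hq => memSeq_kernelHd hq) hp hpt ha n,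
      summable_conv_of_forall_memSeq (fun q hq => memSeq_kernelHplus hq) hp hpt ha n,
      summable_conv_of_forall_memSeq (fun q hq => memSeq_kernelD.mono one_ne_zero hq.le)
        hp hpt ha n,
      Hd_eq_add hp hpt ha n⟩
  · rw [show Hd a = Hplus a + conv kernelD a from funext fun n => Hd_eq_add hp.le hpt ha n]
    refine (eLpNorm_add_le AEStronglyMeasurable.of_discrete AEStronglyMeasurable.of_discrete
      hp.le).trans ?_
    exact add_le_add le_rfl (seqNorm_conv_le hp.le memSeq_kernelD ha)
  · refine ⟨_, weakType_Hplus.mono ?_, fun a ha t ht => distrib_Hd_le ha ht⟩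
    exact le_add_right (by norm_num)
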